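/- Let $f:\mathbb{R}\to\mathbb{R}$ be a bistable reaction function, that is, $f$ is continuously differentiable and for some $\alpha\in(0,1)$ $$f(0)=f(\alpha)=f(1)=0,\qquad f'(0)<0,\ f'(1)<0,\ f'(\alpha)>0,$$ $$f>0\ \text{ on } (-\infty,0)\cup(\alpha,1),\qquad f<0\ \text{ on } (0,\alpha)\cup(1,+\infty).$$ Put $\tau_m:=1/\sup_{u\in[0,1]}|f'(u)|$. For $\tau>0$ consider the relaxation system $$u_t=v_x+f(u),\qquad \tau v_t=u_x-v. \tag{1}$$ A traveling wave of (1) with speed $c\in\mathbb{R}$ connecting $(0,0)$ to $(1,0)$ is a pair of functions $U,V:\mathbb{R}\to\mathbb{R}$ such that $(u,v)(x,t)=(U,V)(x-ct)$ is a classical solution of (1) and $(U,V)(-\infty)=(0,0)$, $(U,V)(+\infty)=(1,0)$. A traveling wave with speed $c$ of the parabolic Allen--Cahn equation $u_t=u_{xx}+f(u)$ connecting $0$ to $1$ is a function $U$ such that $u(x,t)=U(x-ct)$ is a classical solution of that equation and $U(-\infty)=0$, $U(+\infty)=1$. Then for every $\tau\in(0,\tau_m)$ there exists a unique value $c_\ast=c_\ast(\tau)\in(-1/\sqrt{\tau},1/\sqrt{\tau})$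 for which (1) possesses a traveling wave connecting $(0,0)$ to $(1,0)$. Moreover, for every traveling wave $(U,V)$ of (1) with speed $c_\ast(\tau)$ connecting $(0,0)$ to $(1,0)$: (a) $U$ is strictly increasing on $\mathbb{R}$; (b) $U(\xi)>0$ and $V(\xi)>0$ for all $\xi\in\mathbb{R}$, and there are constants $C,\nu>0$ such that $|U(\xi)|,|V(\xi)|\le C e^{-\nu|\xi|}$ for $\xi\le 0$ and $|U(\xi)-1|,|V(\xi)|\le C e^{-\nu|\xi|}$ for $\xi\ge 0$. (c) Finally, the function $\tau\mapsto c_\ast(\tau)$ is continuous on $(0,\tau_m)$, and $c_\ast(\tau)\to c_0$ as $\tau\to0^+$, where $c_0$ is the speed of the parabolic Allen--Cahn equation: the unique real number $c$ (which exists) for which that equation has a traveling wave with speed $c$ connecting $0$ to $1$. -/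

import Mathlib

open Set Filter Topology

/-- A reaction function of bistable form, with continuity of the first derivative as the
smoothness requirement. -/
def IsBistable (f : ℝ → ℝ) : Prop :=
  ContDiff ℝ 1 f ∧
  ∃ α ∈ Ioo (0 : ℝ) 1,
    f 0 = 0 ∧ f α = 0 ∧ f 1 = 0 ∧
    deriv f 0 < 0 ∧ deriv f 1 < 0 ∧ 0 < deriv f α ∧
    (∀ u ∈ Iio (0 : ℝ) ∪ Ioo α 1, 0 < f u) ∧
    (∀ u ∈ Ioo 0 α ∪ Ioi (1 : ℝ), f u < 0)

/-- The threshold `τ_m = 1 / sup_{u ∈ [0,1]} |f'(u)|`. -/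
noncomputable def tauM (f : ℝ → ℝ) : ℝ :=
  1 / sSup ((fun u => |deriv f u|) '' Icc (0 : ℝ) 1)

/-- `(u, v)`, as functions of `x` and `t`, is a classical solution on `ℝ × ℝ` of the relaxation
system `u_t = v_x + f(u)`, `τ v_t = u_x - v`. -/
def IsRelaxationSolution (τ : ℝ) (f : ℝ → ℝ) (u v : ℝ → ℝ → ℝ) : Prop :=
  ∀ x t : ℝ,
    DifferentiableAt ℝ (fun y => u y t) x ∧ DifferentiableAt ℝ (fun s => u x s) t ∧
    DifferentiableAt ℝ (fun y => v y t) x ∧ DifferentiableAt ℝ (fun s => v x s) t ∧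
    deriv (fun s => u x s) t = deriv (fun y => v y t) x + f (u x t) ∧
    τ * deriv (fun s => v x s) t = deriv (fun y => u y t) x - v x t

/-- `(U, V)(x - c t)` is a traveling wave of the relaxation system, connecting the state `(0,0)`
at `-∞` to the state `(1,0)` at `+∞`. -/
def IsRelaxationFront (τ : ℝ) (f : ℝ → ℝ) (c : ℝ) (U V : ℝ → ℝ) : Prop :=
  IsRelaxationSolution τ f (fun x t => U (x - c * t)) (fun x t => V (x - c * t)) ∧
  Tendsto U atBot (𝓝 0) ∧ Tendsto V atBot (𝓝 0) ∧
  Tendsto U atTop (𝓝 1) ∧ Tendsto V atTop (𝓝 0)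

/-- `u`, as a function of `x` and `t`, is a classical solution on `ℝ × ℝ` of the parabolic
Allen--Cahn equation `u_t = u_xx + f(u)`. -/
def IsParabolicSolution (f : ℝ → ℝ) (u : ℝ → ℝ → ℝ) : Prop :=
  ∀ x t : ℝ,
    DifferentiableAt ℝ (fun y => u y t) x ∧
    DifferentiableAt ℝ (deriv (fun y => u y t)) x ∧
    DifferentiableAt ℝ (fun s => u x s) t ∧
    deriv (fun s => u x s) t = deriv (deriv (fun y => u y t)) x + f (u x t)

/-- `U(x - c t)` is a traveling wave of the parabolic Allen--Cahn equation, connecting the state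
`0` at `-∞` to the state `1` at `+∞`. -/
def IsParabolicFront (f : ℝ → ℝ) (c : ℝ) (U : ℝ → ℝ) : Prop :=
  IsParabolicSolution f (fun x t => U (x - c * t)) ∧
  Tendsto U atBot (𝓝 0) ∧ Tendsto U atTop (𝓝 1)

/-! The relaxation system and the parabolic equation are treated together, the latter as `τ = 0`.
With `k = 1 - c² τ > 0`, the profile equations of a front amount to
`k U'' + c (1 - τ f'(U)) U' + f(U) = 0`, and for `0 ≤ τ < τ_m` the damping factor
`g = 1 - τ f'` is positive on `[0, 1]`.

Every front is monotone: the equation at an extremum gives `0 < U < 1`, and the energy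
`k U'² / 2 + ∫₀^U f`, which is monotone because `g > 0`, excludes critical points
(`IsFrontODE.slope_pos`). So `√k U'` is a function `Q` of `U`, which solves `Q Q' = -γ g Q - f` with
`Q(0) = Q(1) = 0` and `Q > 0` in between, where `γ = c / √k` (`IsFrontODE.exists_isProfile`).
Conversely such a profile `Q` gives a front (`IsProfile.exists_isFrontODE`), and
`γ = c / √(1 - c² τ)` is a bijection between the admissible speeds and `ℝ`.

This turns the theorem into a statement on profiles. A comparison of two profiles
(`IsProfile.not_forall_mul_lt`) shows that `γ₁ g₁ < γ₂ g₂` cannot hold on all of `[0, 1]`, whence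
both the uniqueness of `γ` and its continuity in `τ`, down to `τ = 0`. A profile exists
(`exists_isProfile`) by shooting for `E = Q² / 2`, with the square root in
`E' = -γ g √(2 E) - f` regularized, and a compactness argument. The exponential bounds come from
linear bounds for `Q` at the ends of `[0, 1]`.
-/

open scoped NNReal

/-! ### Sign principle, critical points and inverse functions -/

/-- Sign principle: a function that starts out nonnegative and has nonnegative derivative wherever
it is negative stays nonnegative. No differentiability is asked for elsewhere, in particular not at
the endpoints. -/
theorem nonneg_of_hasDerivAt_nonneg_of_neg {D : ℝ → ℝ} {a b : ℝ} (hD : ContinuousOn D (Icc a b))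
    (ha : 0 ≤ D a) (h : ∀ x ∈ Ioo a b, D x < 0 → ∃ d, 0 ≤ d ∧ HasDerivAt D d x) :
    ∀ x ∈ Icc a b, 0 ≤ D x := by
  intro x hx
  by_contra! hneg
  have hcl : IsCompact (Icc a x ∩ D ⁻¹' Ici 0) :=
    isCompact_Icc.of_isClosed_subset
      ((hD.mono (Icc_subset_Icc_right hx.2)).preimage_isClosed_of_isClosed isClosed_Icc isClosed_Ici)
      inter_subset_left
  -- the last point before `x` at which `D` is nonnegative
  obtain ⟨y, ⟨hy, hy0⟩, hmax⟩ := hcl.exists_isGreatest ⟨a, left_mem_Icc.2 hx.1, ha⟩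
  have hyx : y ≠ x := by rintro rfl; exact absurd hy0 (not_le.2 hneg)
  have hlt : ∀ z ∈ Ioc y x, D z < 0 := fun z hz => by
    by_contra! hh
    exact absurd (hmax ⟨⟨hy.1.trans hz.1.le, hz.2⟩, hh⟩) (not_le.2 hz.1)
  have hd : ∀ z ∈ Ioo y x, 0 ≤ deriv D z ∧ DifferentiableAt ℝ D z := fun z hz => by
    obtain ⟨d, hd, hdd⟩ := h z ⟨hy.1.trans_lt hz.1, hz.2.trans_le hx.2⟩ (hlt z ⟨hz.1, hz.2.le⟩)
    exact ⟨hdd.deriv ▸ hd, hdd.differentiableAt⟩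
  have hmono : MonotoneOn D (Icc y x) := by
    refine monotoneOn_of_deriv_nonneg (convex_Icc _ _)
      (hD.mono (Icc_subset_Icc hy.1 hx.2)) ?_ ?_ <;> rw [interior_Icc]
    · exact fun z hz => (hd z hz).2.differentiableWithinAt
    · exact fun z hz => (hd z hz).1
  have := hmono (left_mem_Icc.2 hy.2) (right_mem_Icc.2 hy.2) hy.2
  exact absurd (le_trans hy0 this) (not_le.2 hneg)

/-- The sign principle read from the right end of the interval. -/
theorem nonpos_of_hasDerivAt_nonneg_of_pos {D : ℝ → ℝ} {a b : ℝ} (hD : ContinuousOn D (Icc a b))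
    (hb : D b ≤ 0) (h : ∀ x ∈ Ioo a b, 0 < D x → ∃ d, 0 ≤ d ∧ HasDerivAt D d x) :
    ∀ x ∈ Icc a b, D x ≤ 0 := by
  have key := nonneg_of_hasDerivAt_nonneg_of_neg (D := fun x => -D (a + b - x)) (a := a) (b := b)
    ?_ ?_ ?_
  · intro x hx
    have := key (a + b - x) ⟨by linarith [hx.2], by linarith [hx.1]⟩
    simpa using this
  · refine (hD.comp (by fun_prop) ?_).neg
    intro x hx
    exact ⟨by linarith [hx.2], by linarith [hx.1]⟩
  · simpa using hb
  · intro x hx hneg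
    obtain ⟨d, hd, hdd⟩ := h (a + b - x) ⟨by linarith [hx.2], by linarith [hx.1]⟩ (by simpa using hneg)
    refine ⟨d, hd, ?_⟩
    have := (hdd.comp x ((hasDerivAt_id x).const_sub (a + b))).fun_neg
    simpa [Function.comp_def] using this

/-- At a critical point with negative second derivative, `U` takes smaller values immediately to
the right, so the point is not a local minimum. -/
theorem eventually_lt_right_of_deriv_neg {U W : ℝ → ℝ} {x d : ℝ}
    (hU : ∀ y, HasDerivAt U (W y) y) (hx : W x = 0) (hW : HasDerivAt W d x) (hd : d < 0) :
    ∀ᶠ y in 𝓝[>] x, U y < U x := by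
  have h1 : ∀ᶠ y in 𝓝[>] x, W y < 0 := by
    have h := (hasDerivAt_iff_tendsto_slope.1 hW).eventually_lt_const hd
    have h2 : ∀ᶠ y in 𝓝[>] x, slope W x y < 0 :=
      h.filter_mono (nhdsWithin_mono x (fun y hy => ne_of_gt hy))
    filter_upwards [h2, self_mem_nhdsWithin] with y hy hxy
    rw [slope_def_field, hx, sub_zero] at hy
    by_contra! hh
    exact absurd hy (not_lt.2 (div_nonneg hh (sub_pos.2 hxy).le))
  obtain ⟨b, hb, hbs⟩ := mem_nhdsGT_iff_exists_Ioo_subset.1 h1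
  filter_upwards [Ioo_mem_nhdsGT hb] with y hy
  have := (strictAntiOn_of_hasDerivWithinAt_neg (convex_Icc x y) (f := U) (f' := W)
    (fun z _ => (hU z).continuousAt.continuousWithinAt)
    (fun z _ => (hU z).hasDerivWithinAt)
    (fun z hz => by
      rw [interior_Icc] at hz
      exact hbs ⟨hz.1, hz.2.trans hy.2⟩))
  exact this (left_mem_Icc.2 hy.1.le) (right_mem_Icc.2 hy.1.le) hy.1

/-- The inverse of a strictly increasing differentiable function between open sets, as a function
on `ℝ` (with irrelevant values off `t`), together with its derivative. -/
theorem exists_inverse_of_strictMonoOn {φ φ' : ℝ → ℝ} {s t : Set ℝ} (hs : IsOpen s)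
    (ht : IsOpen t) (hφ : ∀ x ∈ s, HasDerivAt φ (φ' x) x) (hne : ∀ x ∈ s, φ' x ≠ 0)
    (hmono : StrictMonoOn φ s) (himg : φ '' s = t) :
    ∃ ψ : ℝ → ℝ, (∀ y ∈ t, ψ y ∈ s ∧ φ (ψ y) = y) ∧ (∀ x ∈ s, ψ (φ x) = x) ∧
      (∀ y ∈ t, HasDerivAt ψ (φ' (ψ y))⁻¹ y) ∧ StrictMonoOn ψ t := by
  have hex : ∀ y, ∃ x, y ∈ t → x ∈ s ∧ φ x = y := by
    intro y
    by_cases hy : y ∈ t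
    · obtain ⟨x, hx⟩ := himg ▸ hy
      exact ⟨x, fun _ => hx⟩
    · exact ⟨0, fun h => absurd h hy⟩
  choose ψ hψ using hex
  have hinv : ∀ x ∈ s, ψ (φ x) = x := fun x hx => by
    have := hψ (φ x) (himg ▸ mem_image_of_mem φ hx)
    exact hmono.injOn this.1 hx this.2
  have hm : StrictMonoOn ψ t := by
    intro y hy z hz hyz
    rw [← (hψ y hy).2, ← (hψ z hz).2] at hyz
    exact (hmono.lt_iff_lt (hψ y hy).1 (hψ z hz).1).1 hyz
  have himg2 : ψ '' t = s := by
    apply Subset.antisymm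
    · rintro _ ⟨y, hy, rfl⟩; exact (hψ y hy).1
    · intro x hx
      exact ⟨φ x, himg ▸ mem_image_of_mem φ hx, hinv x hx⟩
  refine ⟨ψ, hψ, hinv, fun y hy => ?_, hm⟩
  have hc : ContinuousAt ψ y := hm.continuousAt_of_image_mem_nhds (ht.mem_nhds hy)
    (himg2 ▸ hs.mem_nhds (hψ y hy).1)
  refine HasDerivAt.of_local_left_inverse hc (hφ _ (hψ y hy).1) (hne _ (hψ y hy).1) ?_
  filter_upwards [ht.mem_nhds hy] with z hz using (hψ z hz).2

/-! ### Phase-plane profiles: comparison and linear bounds -/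

theorem deriv_reflect {f : ℝ → ℝ} (u : ℝ) :
    deriv (fun u => -f (1 - u)) u = deriv f (1 - u) := by
  have := deriv_comp_const_sub (f := fun u => -f u) 1 u
  simp [this]

/-- The substitution `u ↦ 1 - u` turns a bistable reaction into another one. It exchanges the two
ends of a front, so that only one end has to be studied. -/
theorem IsBistable.reflect {f : ℝ → ℝ} (hf : IsBistable f) :
    IsBistable (fun u => -f (1 - u)) := by
  obtain ⟨hC, α, hα, h0, hα0, h1, d0, d1, dα, hp, hn⟩ := hf
  refine ⟨(hC.comp (contDiff_const.sub contDiff_id)).neg, 1 - α,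
    ⟨by linarith [hα.2], by linarith [hα.1]⟩, by simp [h1], by simp [hα0], by simp [h0],
    by simpa [deriv_reflect] using d1, by simpa [deriv_reflect] using d0,
    by simpa [deriv_reflect] using dα, ?_, ?_⟩
  · rintro u (hu | hu)
    · have := hn (1 - u) (Or.inr (by have : u < 0 := hu; exact mem_Ioi.2 (by linarith)))
      simpa using this
    · have := hn (1 - u) (Or.inl ⟨by linarith [hu.2], by linarith [hu.1]⟩)
      simpa using this
  · rintro u (hu | hu)
    · have := hp (1 - u) (Or.inr ⟨by linarith [hu.2], by linarith [hu.1]⟩)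
      simpa using this
    · have := hp (1 - u) (Or.inl (by simpa using hu))
      simpa using this

/-- `Q` is a phase-plane profile with speed parameter `γ` for the reaction `f` and the damping `g`:
it vanishes at `0` and `1`, is positive in between, and solves `Q Q' = -γ g Q - f` there. Along a
monotone front, `Q` is the slope of the front, suitably scaled, as a function of its height. -/
structure IsProfile (f g : ℝ → ℝ) (γ : ℝ) (Q : ℝ → ℝ) : Prop where
  cont : ContinuousOn Q (Icc 0 1)
  zero : Q 0 = 0
  one : Q 1 = 0
  pos : ∀ u ∈ Ioo (0 : ℝ) 1, 0 < Q u
  hasDerivAt : ∀ u ∈ Ioo (0 : ℝ) 1, HasDerivAt Q (-γ * g u - f u / Q u) u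

theorem IsProfile.reflect {f g : ℝ → ℝ} {γ : ℝ} {Q : ℝ → ℝ} (h : IsProfile f g γ Q) :
    IsProfile (fun u => -f (1 - u)) (fun u => g (1 - u)) (-γ) (fun u => Q (1 - u)) where
  cont := h.cont.comp (by fun_prop) fun u hu => ⟨by linarith [hu.2], by linarith [hu.1]⟩
  zero := by simpa using h.one
  one := by simpa using h.zero
  pos u hu := h.pos _ ⟨by linarith [hu.2], by linarith [hu.1]⟩
  hasDerivAt u hu := by
    have := (h.hasDerivAt (1 - u) ⟨by linarith [hu.2], by linarith [hu.1]⟩).comp u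
      ((hasDerivAt_id u).const_sub 1)
    simp only [Function.comp_def] at this
    exact this.congr_deriv (by ring)

/-- Comparison of profiles: the product of speed and damping cannot be uniformly larger for one of
two profiles. With `D = Q₁ - Q₂` one has `D' = γ₂ g₂ - γ₁ g₁ + f D / (Q₁ Q₂)`; the sign of `f` gives
`D ≥ 0` on `[0, α]` and `D ≤ 0` on `[α, 1]`, while `D' > 0` at `α`. -/
theorem IsProfile.not_forall_mul_lt {f g₁ g₂ : ℝ → ℝ} {γ₁ γ₂ : ℝ} {Q₁ Q₂ : ℝ → ℝ} {α : ℝ}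
    (hα : α ∈ Ioo (0 : ℝ) 1) (hfα : f α = 0) (hneg : ∀ u ∈ Ioo 0 α, f u < 0)
    (hpos : ∀ u ∈ Ioo α 1, 0 < f u)
    (h₁ : IsProfile f g₁ γ₁ Q₁) (h₂ : IsProfile f g₂ γ₂ Q₂) :
    ¬ ∀ u ∈ Icc (0 : ℝ) 1, γ₁ * g₁ u < γ₂ * g₂ u := by
  intro hlt
  have hcont : ContinuousOn (fun u => Q₁ u - Q₂ u) (Icc 0 1) := h₁.cont.sub h₂.cont
  have hder : ∀ u ∈ Ioo (0 : ℝ) 1, HasDerivAt (fun u => Q₁ u - Q₂ u)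
      (γ₂ * g₂ u - γ₁ * g₁ u + f u * (Q₁ u - Q₂ u) / (Q₁ u * Q₂ u)) u := fun u hu => by
    refine ((h₁.hasDerivAt u hu).fun_sub (h₂.hasDerivAt u hu)).congr_deriv ?_
    have := (h₁.pos u hu).ne'
    have := (h₂.pos u hu).ne'
    field_simp
    ring
  have hL := nonneg_of_hasDerivAt_nonneg_of_neg
    (hcont.mono (Icc_subset_Icc_right hα.2.le)) (by simp [h₁.zero, h₂.zero])
    (fun u hu hD => by
      have hu' : u ∈ Ioo (0 : ℝ) 1 := ⟨hu.1, hu.2.trans hα.2⟩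
      refine ⟨_, ?_, hder u hu'⟩
      have := mul_pos (h₁.pos u hu') (h₂.pos u hu')
      have := div_pos (mul_pos_of_neg_of_neg (hneg u hu) hD) this
      linarith [hlt u (Ioo_subset_Icc_self hu')])
  have hR := nonpos_of_hasDerivAt_nonneg_of_pos
    (hcont.mono (Icc_subset_Icc_left hα.1.le)) (by simp [h₁.one, h₂.one])
    (fun u hu hD => by
      have hu' : u ∈ Ioo (0 : ℝ) 1 := ⟨hα.1.trans hu.1, hu.2⟩
      refine ⟨_, ?_, hder u hu'⟩
      have := mul_pos (h₁.pos u hu') (h₂.pos u hu')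
      have := div_pos (mul_pos (hpos u hu) hD) this
      linarith [hlt u (Ioo_subset_Icc_self hu')])
  have hz : Q₁ α - Q₂ α = 0 :=
    le_antisymm (hR α ⟨le_rfl, hα.2.le⟩) (hL α ⟨hα.1.le, le_rfl⟩)
  have hd := hder α hα
  rw [hfα, zero_mul, zero_div, add_zero] at hd
  have hd0 : 0 < γ₂ * g₂ α - γ₁ * g₁ α := sub_pos.2 (hlt α (Ioo_subset_Icc_self hα))
  have h := ((hasDerivAt_iff_tendsto_slope.1 hd).eventually_const_lt hd0).filter_mono
    (nhdsWithin_mono α (fun y (hy : y ∈ Ioi α) => ne_of_gt hy))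
  obtain ⟨y, hy, hy1, hyα⟩ :=
    (h.and (Ioo_mem_nhdsGT hα.2)).exists
  rw [slope_def_field, hz, sub_zero] at hy
  have := hR y ⟨hy1.le, hyα.le⟩
  exact absurd hy (not_lt.2 (div_nonpos_of_nonpos_of_nonneg this (sub_pos.2 hy1).le))

theorem IsBistable.exists_abs_le {f : ℝ → ℝ} (hf : IsBistable f) :
    ∃ L > 0, ∀ u ∈ Icc (0 : ℝ) 1, |f u| ≤ L * u := by
  obtain ⟨hC, α, hα, h0, -⟩ := hf
  obtain ⟨L, hL⟩ := (isCompact_Icc (a := (0 : ℝ)) (b := 1)).exists_bound_of_continuousOn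
    (hC.continuous_deriv le_rfl).continuousOn
  refine ⟨L ⊔ 1, by positivity, fun u hu => ?_⟩
  have := (convex_Icc (0 : ℝ) 1).norm_image_sub_le_of_norm_deriv_le (f := f)
    (fun x _ => hC.differentiable one_ne_zero x) hL (left_mem_Icc.2 zero_le_one) hu
  rw [h0, sub_zero, sub_zero, Real.norm_eq_abs, Real.norm_eq_abs, abs_of_nonneg hu.1] at this
  exact this.trans (mul_le_mul_of_nonneg_right le_sup_left hu.1)

theorem IsBistable.exists_le_neg {f : ℝ → ℝ} (hf : IsBistable f) :
    ∃ l > 0, ∃ b ∈ Ioo (0 : ℝ) 1, ∀ u ∈ Icc 0 b, l * u ≤ -f u := by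
  obtain ⟨hC, α, hα, h0, -, -, d0, -⟩ := hf
  have hd := (hC.differentiable one_ne_zero 0).hasDerivAt
  have h := ((hasDerivAt_iff_tendsto_slope.1 hd).eventually_lt_const
    (show deriv f 0 < deriv f 0 / 2 by linarith)).filter_mono
    (nhdsWithin_mono 0 (fun y (hy : y ∈ Ioi 0) => ne_of_gt hy))
  obtain ⟨b, hb, hbs⟩ := mem_nhdsGT_iff_exists_Ioo_subset.1 h
  have hb : (0 : ℝ) < b := hb
  refine ⟨-(deriv f 0 / 2), by linarith, min (b / 2) (1 / 2),
    ⟨by positivity, (min_le_right _ _).trans_lt (by norm_num)⟩, fun u hu => ?_⟩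
  rcases hu.1.eq_or_lt with rfl | hu0
  · simp [h0]
  have := hbs ⟨hu0, (hu.2.trans (min_le_left _ _)).trans_lt (by linarith)⟩
  simp only [mem_ofPred_eq, slope_def_field, h0, sub_zero] at this
  rw [div_lt_iff₀ hu0] at this
  linarith

/-- A profile grows at most linearly at `0`; hence the front it generates needs infinite time to
reach the state `0`. -/
theorem IsProfile.exists_le_mul {f g : ℝ → ℝ} {γ : ℝ} {Q : ℝ → ℝ} (h : IsProfile f g γ Q)
    (hf : IsBistable f) (hg : ContinuousOn g (Icc 0 1)) :
    ∃ C > 0, ∀ u ∈ Icc (0 : ℝ) 1, Q u ≤ C * u := by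
  obtain ⟨L, hL, hfL⟩ := hf.exists_abs_le
  obtain ⟨G, hG⟩ := (isCompact_Icc (a := (0 : ℝ)) (b := 1)).exists_bound_of_continuousOn
    (show ContinuousOn (fun u => γ * g u) (Icc 0 1) from continuousOn_const.mul hg)
  have hG0 : 0 ≤ G := (norm_nonneg _).trans (hG 0 (left_mem_Icc.2 zero_le_one))
  have hC : 0 < G + L + 1 := by positivity
  refine ⟨G + L + 1, hC, fun u hu => ?_⟩
  have := nonneg_of_hasDerivAt_nonneg_of_neg (D := fun u => (G + L + 1) * u - Q u)
    ((continuousOn_const.mul continuousOn_id).sub h.cont) (by simp [h.zero])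
    (fun u hu hD => by
      refine ⟨_, ?_, ((hasDerivAt_id u).const_mul (G + L + 1)).fun_sub (h.hasDerivAt u hu)⟩
      have h1 := (abs_le.1 (hG u (Ioo_subset_Icc_self hu))).1
      have h2 := (abs_le.1 (hfL u (Ioo_subset_Icc_self hu))).1
      have hQ := h.pos u hu
      have h3 : -L ≤ f u / Q u := by
        rw [le_div_iff₀ hQ]
        have h4 : 0 ≤ Q u - u := by nlinarith [hu.1, mul_nonneg (add_nonneg hG0 hL.le) hu.1.le]
        nlinarith [hu.1, mul_nonneg hL.le h4]
      linarith) u hu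
  linarith

/-- A profile grows at least linearly at `0`; hence the front it generates decays exponentially. -/
theorem IsProfile.exists_mul_le {f g : ℝ → ℝ} {γ : ℝ} {Q : ℝ → ℝ} (h : IsProfile f g γ Q)
    (hf : IsBistable f) (hg : ContinuousOn g (Icc 0 1)) :
    ∃ δ > 0, ∃ b ∈ Ioo (0 : ℝ) 1, ∀ u ∈ Icc (0 : ℝ) b, δ * u ≤ Q u := by
  obtain ⟨l, hl, b, hb, hfl⟩ := hf.exists_le_neg
  obtain ⟨G, hG⟩ := (isCompact_Icc (a := (0 : ℝ)) (b := 1)).exists_bound_of_continuousOn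
    (show ContinuousOn (fun u => γ * g u) (Icc 0 1) from continuousOn_const.mul hg)
  have hG0 : 0 ≤ G := (norm_nonneg _).trans (hG 0 (left_mem_Icc.2 zero_le_one))
  have hC : 0 < G + l + 1 := by positivity
  refine ⟨l / (G + l + 1), by positivity, b, hb, fun u hu => ?_⟩
  have hδ1 : l / (G + l + 1) ≤ 1 := (div_le_one hC).2 (by linarith)
  have := nonneg_of_hasDerivAt_nonneg_of_neg (D := fun u => Q u - l / (G + l + 1) * u)
    ((h.cont.mono (Icc_subset_Icc_right hb.2.le)).sub (continuousOn_const.mul continuousOn_id))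
    (by simp [h.zero])
    (fun u hu hD => by
      have hu' : u ∈ Ioo (0 : ℝ) 1 := ⟨hu.1, hu.2.trans hb.2⟩
      refine ⟨_, ?_, (h.hasDerivAt u hu').fun_sub ((hasDerivAt_id u).const_mul (l / (G + l + 1)))⟩
      have h1 := (abs_le.1 (hG u (Ioo_subset_Icc_self hu'))).2
      have h2 := hfl u (Ioo_subset_Icc_self hu)
      have hQ := h.pos u hu'
      have h3 : G + l + 1 ≤ -f u / Q u := by
        rw [le_div_iff₀ hQ]
        have : Q u < l / (G + l + 1) * u := by linarith
        rw [div_mul_eq_mul_div, lt_div_iff₀ hC] at this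
        linarith
      rw [neg_div] at h3
      linarith) u hu
  linarith

/-! ### The regularized energy equation -/

/-- A bounded Lipschitz regularization of `y ↦ √(2 y)`: the argument is clamped to `[ε, K]`. -/
noncomputable def sqrtReg (K ε y : ℝ) : ℝ := √(2 * min (max y ε) K)

theorem sqrtReg_nonneg (K ε y : ℝ) : 0 ≤ sqrtReg K ε y := Real.sqrt_nonneg _

theorem sqrtReg_le (K ε y : ℝ) : sqrtReg K ε y ≤ √(2 * K) :=
  Real.sqrt_le_sqrt (by linarith [min_le_right (max y ε) K])

theorem le_sqrtReg {K ε y m : ℝ} (hmy : m ≤ y) (hmK : m ≤ K) : √(2 * m) ≤ sqrtReg K ε y :=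
  Real.sqrt_le_sqrt (by linarith [le_min (hmy.trans (le_max_left y ε)) hmK])

theorem continuous_sqrtReg (K : ℝ) : Continuous fun p : ℝ × ℝ => sqrtReg K p.1 p.2 := by
  unfold sqrtReg; fun_prop

theorem exists_lipschitzWith_sqrtReg {K ε : ℝ} (hε : 0 < ε) (hεK : ε ≤ K) :
    ∃ l : ℝ≥0, LipschitzWith l (sqrtReg K ε) := by
  have h1 : LipschitzWith 1 fun y : ℝ => min (max y ε) K :=
    (LipschitzWith.id.max_const ε).min_const K
  have hs : 0 < √(2 * ε) := Real.sqrt_pos.2 (by linarith)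
  refine ⟨_, LipschitzWith.of_dist_le' (K := 2 / √(2 * ε)) fun x y => ?_⟩
  have h2 := h1.dist_le_mul x y
  have hx : ε ≤ min (max x ε) K := le_min (le_max_right _ _) hεK
  have hy : ε ≤ min (max y ε) K := le_min (le_max_right _ _) hεK
  simp only [sqrtReg, NNReal.coe_one, one_mul, Real.dist_eq] at h2 ⊢
  generalize min (max x ε) K = a at *
  generalize min (max y ε) K = b at *
  have ha : √(2 * ε) ≤ √(2 * a) := Real.sqrt_le_sqrt (by linarith)
  have hb : √(2 * ε) ≤ √(2 * b) := Real.sqrt_le_sqrt (by linarith)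
  have e : (√(2 * a) - √(2 * b)) * (√(2 * a) + √(2 * b)) = 2 * (a - b) := by
    have := Real.mul_self_sqrt (show 0 ≤ 2 * a by linarith)
    have := Real.mul_self_sqrt (show 0 ≤ 2 * b by linarith)
    linarith
  have e2 : |√(2 * a) - √(2 * b)| * (√(2 * a) + √(2 * b)) = 2 * |a - b| := by
    rw [← abs_of_pos (show 0 < √(2 * a) + √(2 * b) by linarith), ← abs_mul, e, abs_mul, abs_two]
  rw [div_mul_eq_mul_div, le_div_iff₀ hs]
  nlinarith [abs_nonneg (√(2 * a) - √(2 * b))]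

/-- `E` solves the regularized energy equation `E' = -γ g √(2 E) - f` on `[0, 1]`, which for
`E = Q ^ 2 / 2` and without regularization is the equation of profiles. -/
def IsRegEnergy (f g : ℝ → ℝ) (γ K ε : ℝ) (E : ℝ → ℝ) : Prop :=
  ∀ t ∈ Icc (0 : ℝ) 1,
    HasDerivWithinAt E (-γ * g t * sqrtReg K ε (E t) - f t) (Icc 0 1) t

theorem IsRegEnergy.hasDerivWithinAt_Ici {f g : ℝ → ℝ} {γ K ε : ℝ} {E : ℝ → ℝ}
    (h : IsRegEnergy f g γ K ε E) {t : ℝ} (ht : t ∈ Ico (0 : ℝ) 1) :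
    HasDerivWithinAt E (-γ * g t * sqrtReg K ε (E t) - f t) (Ici t) t :=
  (h t (Ico_subset_Icc_self ht)).mono_of_mem_nhdsWithin (Icc_mem_nhdsGE_of_mem ht)

theorem IsRegEnergy.continuousOn {f g : ℝ → ℝ} {γ K ε : ℝ} {E : ℝ → ℝ}
    (h : IsRegEnergy f g γ K ε E) : ContinuousOn E (Icc 0 1) :=
  fun t ht => (h t ht).continuousWithinAt

theorem IsRegEnergy.reflect {f g : ℝ → ℝ} {γ K ε : ℝ} {E : ℝ → ℝ} (h : IsRegEnergy f g γ K ε E) :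
    IsRegEnergy (fun u => -f (1 - u)) (fun u => g (1 - u)) (-γ) K ε (fun u => E (1 - u)) := by
  intro t ht
  have := (h (1 - t) ⟨by linarith [ht.2], by linarith [ht.1]⟩).comp t
    (((hasDerivAt_id t).const_sub 1).hasDerivWithinAt (s := Icc 0 1))
    (fun u hu => ⟨by simpa using hu.2, by simpa using hu.1⟩)
  exact this.congr_deriv (by ring)

theorem abs_regEnergy_rhs_le {f g : ℝ → ℝ} {γ K ε R G M : ℝ}
    (hγ : |γ| ≤ R) (hG : ∀ t ∈ Icc (0 : ℝ) 1, |g t| ≤ G) (hM : ∀ t ∈ Icc (0 : ℝ) 1, |f t| ≤ M)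
    {t : ℝ} (ht : t ∈ Icc (0 : ℝ) 1) (y : ℝ) :
    |-γ * g t * sqrtReg K ε y - f t| ≤ R * G * √(2 * K) + M := by
  have h1 : |-γ * g t * sqrtReg K ε y| ≤ R * G * √(2 * K) := by
    rw [abs_mul, abs_mul, abs_neg, abs_of_nonneg (sqrtReg_nonneg K ε y)]
    have := hG t ht
    have := sqrtReg_le K ε y
    have := sqrtReg_nonneg K ε y
    have := (abs_nonneg γ).trans hγ
    have := (abs_nonneg (g t)).trans (hG t ht)
    gcongr
  exact (abs_sub _ _).trans (add_le_add h1 (hM t ht))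

theorem exists_lipschitzWith_regEnergy_rhs (f : ℝ → ℝ) {g : ℝ → ℝ} (hg : Continuous g) {K ε : ℝ}
    (hε : 0 < ε) (hεK : ε ≤ K) (γ : ℝ) :
    ∃ l : ℝ≥0, ∀ t ∈ Icc (0 : ℝ) 1,
      LipschitzWith l fun y => -γ * g t * sqrtReg K ε y - f t := by
  obtain ⟨l, hl⟩ := exists_lipschitzWith_sqrtReg hε hεK
  obtain ⟨G, hG⟩ := (isCompact_Icc (a := (0 : ℝ)) (b := 1)).exists_bound_of_continuousOn
    hg.continuousOn
  refine ⟨_, fun t ht => LipschitzWith.of_dist_le' (K := |γ| * G * l) fun x y => ?_⟩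
  have h2 := hl.dist_le_mul x y
  rw [Real.dist_eq, Real.dist_eq] at *
  rw [sub_sub_sub_cancel_right, ← mul_sub, abs_mul, abs_mul, abs_neg, mul_assoc (|γ| * G)]
  have := hG t ht
  rw [Real.norm_eq_abs] at this
  have := (abs_nonneg _).trans this
  gcongr

theorem exists_isRegEnergy {f g : ℝ → ℝ} (hf : Continuous f) (hg : Continuous g) {K ε : ℝ}
    (hε : 0 < ε) (hεK : ε ≤ K) (γ : ℝ) :
    ∃ E, E 0 = 0 ∧ IsRegEnergy f g γ K ε E := by
  obtain ⟨l, hl⟩ := exists_lipschitzWith_regEnergy_rhs f hg hε hεK γ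
  obtain ⟨G, hG⟩ := (isCompact_Icc (a := (0 : ℝ)) (b := 1)).exists_bound_of_continuousOn
    hg.continuousOn
  obtain ⟨M, hM⟩ := (isCompact_Icc (a := (0 : ℝ)) (b := 1)).exists_bound_of_continuousOn
    hf.continuousOn
  have h0 : (0 : ℝ) ∈ Icc (0 : ℝ) 1 := left_mem_Icc.2 zero_le_one
  have hL := fun t ht => abs_regEnergy_rhs_le (K := K) (ε := ε) (γ := γ) le_rfl hG hM (t := t) ht
  have hL0 : 0 ≤ |γ| * G * √(2 * K) + M := (abs_nonneg _).trans (hL 0 h0 0)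
  have hPL : IsPicardLindelof (fun t y => -γ * g t * sqrtReg K ε y - f t)
      (tmin := 0) (tmax := 1) ⟨0, h0⟩ (0 : ℝ) ⟨_, hL0⟩ 0 ⟨_, hL0⟩ l := by
    refine ⟨fun t ht => ?_, fun y _ => ?_, fun t ht y _ => hL t ht y, by simp⟩
    · exact (hl t ht).lipschitzOnWith
    · fun_prop
  obtain ⟨E, hE0, hE⟩ := hPL.exists_eq_forall_mem_Icc_hasDerivWithinAt₀
  exact ⟨E, hE0, hE⟩

/-- The end value of the regularized solution depends continuously on `γ`, by Grönwall. -/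
theorem continuous_regEnergy_apply_one {f g : ℝ → ℝ} (hg : Continuous g) {K ε : ℝ}
    (hε : 0 < ε) (hεK : ε ≤ K) {E : ℝ → ℝ → ℝ} (hE0 : ∀ γ, E γ 0 = 0)
    (hE : ∀ γ, IsRegEnergy f g γ K ε (E γ)) : Continuous fun γ => E γ 1 := by
  obtain ⟨G, hG⟩ := (isCompact_Icc (a := (0 : ℝ)) (b := 1)).exists_bound_of_continuousOn
    hg.continuousOn
  have h0 : (0 : ℝ) ∈ Icc (0 : ℝ) 1 := left_mem_Icc.2 zero_le_one
  have hG0 : 0 ≤ G := (abs_nonneg _).trans (hG 0 h0)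
  refine continuous_iff_continuousAt.2 fun γ => ?_
  obtain ⟨l, hl⟩ := exists_lipschitzWith_regEnergy_rhs f hg hε hεK γ
  have key : ∀ γ', dist (E γ' 1) (E γ 1) ≤
      gronwallBound 0 l (|γ' - γ| * (G * √(2 * K)) + 0)
        (1 - 0) := by
    intro γ'
    refine dist_le_of_approx_trajectories_ODE_of_mem (s := fun _ => univ)
      (v := fun t y => -γ * g t * sqrtReg K ε y - f t) (fun t ht => ?_)
      (hE γ').continuousOn (fun t ht => (hE γ').hasDerivWithinAt_Ici ht) (fun t ht => ?_)
      (fun _ _ => mem_univ _)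
      (hE γ).continuousOn (fun t ht => (hE γ).hasDerivWithinAt_Ici ht) (fun t ht => ?_)
      (fun _ _ => mem_univ _) (by simp [hE0]) 1 (right_mem_Icc.2 zero_le_one)
    · exact (hl t (Ico_subset_Icc_self ht)).lipschitzOnWith
    · rw [Real.dist_eq, sub_sub_sub_cancel_right, ← sub_mul, ← sub_mul, abs_mul, abs_mul,
        ← abs_neg, abs_of_nonneg (sqrtReg_nonneg _ _ _), mul_assoc]
      have := hG t (Ico_subset_Icc_self ht)
      rw [Real.norm_eq_abs] at this
      have := sqrtReg_le K ε (E γ' t)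
      have := sqrtReg_nonneg K ε (E γ' t)
      rw [show -(-γ' - -γ) = γ' - γ by ring]
      gcongr
    · simp
  refine tendsto_iff_dist_tendsto_zero.2 (squeeze_zero (fun _ => dist_nonneg) key ?_)
  have hc : Continuous fun γ' : ℝ => gronwallBound 0 l
      (|γ' - γ| * (G * √(2 * K)) + 0) (1 - 0) :=
    (gronwallBound_continuous_ε _ _ _).comp (by fun_prop)
  have := hc.tendsto γ
  simpa [gronwallBound_ε0_δ0] using this

/-- For `γ = -R` with `R` large the regularized solution ends at a positive value: on `[0, b]` it
gains at least `∫ -f`, and it cannot fall below that level again because there the term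
`R g √(2 E)` dominates `f`. The bound does not depend on `ε`. -/
theorem IsRegEnergy.le_apply_one {f g : ℝ → ℝ} {R K ε g₀ M b : ℝ} {E : ℝ → ℝ}
    (h : IsRegEnergy f g (-R) K ε E) (hf : Continuous f) (hE0 : 0 ≤ E 0) (hb : b ∈ Icc (0 : ℝ) 1)
    (hR : 0 ≤ R) (hg0 : 0 ≤ g₀) (hg : ∀ t ∈ Icc (0 : ℝ) 1, g₀ ≤ g t)
    (hM : ∀ t ∈ Icc (0 : ℝ) 1, |f t| ≤ M) (hK : ∫ t in 0..b, -f t ≤ K) (hRM : M < R * g₀ * √(2 * ∫ t in 0..b, -f t)) :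
    ∫ t in 0..b, -f t ≤ E 1 := by
  have hb1 : ∫ t in 0..b, -f t ≤ E b := by
    refine image_le_of_deriv_right_le_deriv_boundary (a := 0) (b := b)
      (f := fun x => ∫ t in 0..x, -f t) (f' := fun x => -f x) (B := E)
      (B' := fun t => -(-R) * g t * sqrtReg K ε (E t) - f t) ?_ ?_ (by simpa using hE0)
      (h.continuousOn.mono (Icc_subset_Icc_right hb.2)) ?_ ?_ (right_mem_Icc.2 hb.1)
    · exact fun x _ => (hf.neg.integral_hasStrictDerivAt 0 x).hasDerivAt.continuousAt.continuousWithinAt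
    · exact fun x _ => (hf.neg.integral_hasStrictDerivAt 0 x).hasDerivAt.hasDerivWithinAt
    · exact fun x hx => h.hasDerivWithinAt_Ici ⟨hx.1, hx.2.trans_le hb.2⟩
    · intro x hx
      have := hg x ⟨hx.1, (hx.2.trans_le hb.2).le⟩
      have := mul_nonneg (mul_nonneg hR (hg0.trans this)) (sqrtReg_nonneg K ε (E x))
      linarith
  refine image_le_of_deriv_right_lt_deriv_boundary' (a := b) (b := 1)
    (f := fun _ => ∫ t in 0..b, -f t) (f' := fun _ => 0) (B := E)
    (B' := fun t => -(-R) * g t * sqrtReg K ε (E t) - f t) continuousOn_const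
    (fun x _ => hasDerivWithinAt_const ..) hb1
    (h.continuousOn.mono (Icc_subset_Icc_left hb.1)) ?_ ?_ (right_mem_Icc.2 hb.2)
  · exact fun x hx => h.hasDerivWithinAt_Ici ⟨hb.1.trans hx.1, hx.2⟩
  · intro x hx hEx
    have hx' : x ∈ Icc (0 : ℝ) 1 := ⟨hb.1.trans hx.1, hx.2.le⟩
    have h1 := le_sqrtReg (ε := ε) hEx.le hK
    have h2 := hg x hx'
    have h3 := (abs_le.1 (hM x hx')).2
    have : R * g₀ * √(2 * ∫ t in 0..b, -f t) ≤ R * g x * sqrtReg K ε (E x) := by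
      gcongr
      exact mul_nonneg hR (hg0.trans h2)
    simp only [neg_neg]
    linarith

/-! ### Existence of profiles -/

/-- Arzelà–Ascoli for a sequence of equi-Lipschitz functions with a bounded sequence of
parameters. -/
theorem exists_subseq_tendsto_of_lipschitzOnWith {E : ℕ → ℝ → ℝ} {γ : ℕ → ℝ} {K : ℝ≥0} {R : ℝ}
    (hE : ∀ n, LipschitzOnWith K (E n) (Icc 0 1)) (hE0 : ∀ n, E n 0 = 0) (hγ : ∀ n, |γ n| ≤ R) :
    ∃ (φ : ℕ → ℕ) (E' : ℝ → ℝ) (γ' : ℝ), StrictMono φ ∧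
      (∀ x ∈ Icc (0 : ℝ) 1, Tendsto (fun n => E (φ n) x) atTop (𝓝 (E' x))) ∧
      Tendsto (fun n => γ (φ n)) atTop (𝓝 γ') := by
  have h0 : (0 : ℝ) ∈ Icc (0 : ℝ) 1 := left_mem_Icc.2 zero_le_one
  let A : Set (BoundedContinuousFunction (Icc (0 : ℝ) 1) ℝ) :=
    {F | LipschitzWith K F} ∩ ⋂ x, (fun F => F x) ⁻¹' Icc (-(K : ℝ)) K
  have hA : IsCompact A := by
    refine BoundedContinuousFunction.arzela_ascoli₂ (Icc (-(K : ℝ)) K) isCompact_Icc A ?_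
      (fun F x hF => mem_iInter.1 hF.2 x) ?_
    · refine IsClosed.inter ?_ ?_
      · exact (isClosed_setOfPred_lipschitzWith K).preimage
          (BoundedContinuousFunction.continuous_coe (α := Icc (0 : ℝ) 1) (β := ℝ))
      · exact isClosed_iInter fun x => isClosed_Icc.preimage (continuous_eval_const x)
    · exact (LipschitzWith.uniformEquicontinuous _ K (fun F : A => F.2.1)).equicontinuous
  let F : ℕ → BoundedContinuousFunction (Icc (0 : ℝ) 1) ℝ := fun n =>
    BoundedContinuousFunction.mkOfCompact
      ⟨(Icc (0 : ℝ) 1).domRestrict (E n), (hE n).continuousOn.domRestrict⟩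
  have hF : ∀ n, F n ∈ A := fun n => by
    refine ⟨(hE n).to_restrict, mem_iInter.2 fun x => abs_le.1 ?_⟩
    have h := (hE n).dist_le_mul x x.2 0 h0
    rw [hE0, Real.dist_eq, Real.dist_eq, sub_zero, sub_zero, abs_of_nonneg x.2.1] at h
    exact h.trans (mul_le_of_le_one_right K.2 x.2.2)
  obtain ⟨⟨E', γ'⟩, -, φ, hφ, hlim⟩ := (hA.prod (isCompact_Icc (a := -R) (b := R))).tendsto_subseq
    (x := fun n => (F n, γ n)) (fun n => ⟨hF n, abs_le.1 (hγ n)⟩)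
  refine ⟨φ, fun x => E' (projIcc 0 1 zero_le_one x), γ', hφ, fun x hx => ?_, ?_⟩
  · have h1 : Tendsto (fun n => F (φ n)) atTop (𝓝 E') := (continuous_fst.tendsto _).comp hlim
    have h2 := ((continuous_eval_const (⟨x, hx⟩ : Icc (0 : ℝ) 1)).tendsto E').comp h1
    simp only [projIcc_of_mem zero_le_one hx]
    exact h2
  · exact (continuous_snd.tendsto _).comp hlim

/-- Shooting: for every `ε` some `γ`, bounded independently of `ε`, makes the regularized solution
vanish at both ends. The bound `R * G * √(2 * K) + M ≤ K` makes the upper clamp inactive. -/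
theorem exists_isRegEnergy_one_eq_zero {f g : ℝ → ℝ} {α : ℝ} (hf : Continuous f) (hg : Continuous g)
    (hgpos : ∀ u ∈ Icc (0 : ℝ) 1, 0 < g u) (hα : α ∈ Ioo (0 : ℝ) 1)
    (hneg : ∀ u ∈ Ioo 0 α, f u < 0) (hpos : ∀ u ∈ Ioo α 1, 0 < f u) :
    ∃ R, ∃ K > 0, ∃ G M, (∀ t ∈ Icc (0 : ℝ) 1, |g t| ≤ G) ∧ (∀ t ∈ Icc (0 : ℝ) 1, |f t| ≤ M) ∧
      R * G * √(2 * K) + M ≤ K ∧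
      ∀ ε, 0 < ε → ε ≤ K → ∃ γ, |γ| ≤ R ∧ ∃ E, E 0 = 0 ∧ E 1 = 0 ∧ IsRegEnergy f g γ K ε E := by
  obtain ⟨G, hG⟩ := (isCompact_Icc (a := (0 : ℝ)) (b := 1)).exists_bound_of_continuousOn
    hg.continuousOn
  obtain ⟨M, hM⟩ := (isCompact_Icc (a := (0 : ℝ)) (b := 1)).exists_bound_of_continuousOn
    hf.continuousOn
  obtain ⟨w, hw, hmin⟩ := (isCompact_Icc (a := (0 : ℝ)) (b := 1)).exists_isMinOn
    (nonempty_Icc.2 zero_le_one) hg.continuousOn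
  have h0 : (0 : ℝ) ∈ Icc (0 : ℝ) 1 := left_mem_Icc.2 zero_le_one
  have hg0 := hgpos w hw
  have hM0 : 0 ≤ M := (abs_nonneg _).trans (hM 0 h0)
  have hG0 : 0 ≤ G := (abs_nonneg _).trans (hG 0 h0)
  have hm₁ : 0 < ∫ t in 0..α, -f t :=
    intervalIntegral.intervalIntegral_pos_of_pos_on (hf.neg.intervalIntegrable _ _)
      (fun x hx => neg_pos.2 (hneg x hx)) hα.1
  have hf' : Continuous fun u => -f (1 - u) := by fun_prop
  have hm₂ : 0 < ∫ t in 0..(1 - α), - -f (1 - t) :=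
    intervalIntegral.intervalIntegral_pos_of_pos_on (hf'.neg.intervalIntegrable _ _)
      (fun x hx => by
        simpa using hpos (1 - x) ⟨by linarith [hx.2], by linarith [hx.1]⟩) (sub_pos.2 hα.2)
  have large : ∀ m, 0 < m → ∃ R₀ ≥ (0 : ℝ), ∀ R ≥ R₀, M < R * g w * √(2 * m) := by
    intro m hm
    have hp : 0 < g w * √(2 * m) := by positivity
    refine ⟨(M + 1) / (g w * √(2 * m)), by positivity, fun R hR => ?_⟩
    rw [ge_iff_le, div_le_iff₀ hp] at hR
    linarith
  -- `R` serves the equation and its reflection, which excludes a positive end value for `γ = R`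
  obtain ⟨R₁, hR₁, hR₁'⟩ := large _ hm₁
  obtain ⟨R₂, hR₂, hR₂'⟩ := large _ hm₂
  set R := max R₁ R₂ with hRdef
  have hR : 0 ≤ R := hR₁.trans (le_max_left _ _)
  have hRG : 0 ≤ R * G := mul_nonneg hR hG0
  set m₁ := ∫ t in 0..α, -f t with hm₁def
  set m₂ := ∫ t in 0..(1 - α), - -f (1 - t) with hm₂def
  -- the sum of the first two terms already gives `R * G * √(2 * K) + M ≤ K`
  set K := 2 * (R * G) ^ 2 + 2 * M + m₁ + m₂ with hKdef
  have hK : 0 < K := by positivity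
  have hKm₁ : m₁ ≤ K := by nlinarith [sq_nonneg (R * G)]
  have hKm₂ : m₂ ≤ K := by nlinarith [sq_nonneg (R * G)]
  refine ⟨R, K, hK, G, M, hG, hM, ?_, fun ε hε hεK => ?_⟩
  · have := Real.sq_sqrt (show 0 ≤ 2 * K by positivity)
    nlinarith [sq_nonneg (√(2 * K) - 2 * (R * G))]
  choose E hE0 hE using exists_isRegEnergy hf hg hε hεK
  have hL : 0 ≤ E (-R) 1 := hm₁.le.trans <|
    (hE (-R)).le_apply_one hf (hE0 _).ge (Ioo_subset_Icc_self hα) hR hg0.le hmin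
      hM hKm₁ (hR₁' _ (le_max_left _ _))
  have hr : E R 1 ≤ 0 := by
    by_contra! hlt
    have h := (hE R).reflect.le_apply_one hf' (by simpa using hlt.le)
      (b := 1 - α) ⟨by linarith [hα.2], by linarith [hα.1]⟩ hR hg0.le
      (fun t ht => hmin (show 1 - t ∈ Icc (0 : ℝ) 1 from ⟨by linarith [ht.2], by linarith [ht.1]⟩))
      (M := M) (fun t ht => by
        rw [abs_neg]
        exact hM (1 - t) ⟨by linarith [ht.2], by linarith [ht.1]⟩)
      hKm₂ (hR₂' _ (le_max_right _ _))
    simp only [sub_self, hE0] at h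
    exact absurd hm₂ (not_lt.2 h)
  obtain ⟨γ, hγ, hγ0⟩ := intermediate_value_Icc' (show -R ≤ R by linarith)
    (continuous_regEnergy_apply_one hg hε hεK hE0 hE).continuousOn ⟨hr, hL⟩
  exact ⟨γ, abs_le.2 hγ, E γ, hE0 γ, hγ0, hE γ⟩

/-- The limit `ε → 0` of the regularized solutions that vanish at both ends. -/
theorem exists_energy {f g : ℝ → ℝ} {α : ℝ} (hf : Continuous f) (hg : Continuous g)
    (hgpos : ∀ u ∈ Icc (0 : ℝ) 1, 0 < g u) (hα : α ∈ Ioo (0 : ℝ) 1)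
    (hneg : ∀ u ∈ Ioo 0 α, f u < 0) (hpos : ∀ u ∈ Ioo α 1, 0 < f u) :
    ∃ (γ : ℝ) (E : ℝ → ℝ), E 0 = 0 ∧ E 1 = 0 ∧ ContinuousOn E (Icc 0 1) ∧
      ∀ u ∈ Ioo (0 : ℝ) 1, HasDerivAt E (-γ * g u * √(2 * max (E u) 0) - f u) u := by
  obtain ⟨R, K, hK, G, M, hG, hM, hRK, hex⟩ := exists_isRegEnergy_one_eq_zero hf hg hgpos hα hneg hpos
  have h0 : (0 : ℝ) ∈ Icc (0 : ℝ) 1 := left_mem_Icc.2 zero_le_one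
  choose! γ hγ E hE0 hE1 hE using hex
  set ε : ℕ → ℝ := fun n => K / (n + 1) with hεdef
  have hε : ∀ n, 0 < ε n := fun n => by positivity
  have hεK : ∀ n, ε n ≤ K := fun n => div_le_self hK.le (by linarith [(Nat.cast_nonneg n : (0:ℝ) ≤ n)])
  have hεlim : Tendsto ε atTop (𝓝 0) := by
    simpa [hεdef, div_eq_mul_inv] using (tendsto_one_div_add_atTop_nhds_zero_nat (𝕜 := ℝ)).const_mul K
  have hlip : ∀ n, LipschitzOnWith ⟨K, hK.le⟩ (E (ε n)) (Icc 0 1) := fun n =>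
    (convex_Icc 0 1).lipschitzOnWith_of_nnnorm_hasDerivWithin_le (hE _ (hε n) (hεK n))
      fun t ht => (abs_regEnergy_rhs_le (hγ _ (hε n) (hεK n)) hG hM ht _).trans hRK
  obtain ⟨φ, E', γ', hφ, hE', hγ'⟩ := exists_subseq_tendsto_of_lipschitzOnWith hlip
    (fun n => hE0 _ (hε n) (hεK n)) (fun n => hγ _ (hε n) (hεK n))
  have hlim1 : ∀ x ∈ Icc (0 : ℝ) 1, ∀ y ∈ Icc (0 : ℝ) 1, |E' x - E' y| ≤ K * |x - y| := by
    intro x hx y hy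
    exact le_of_tendsto ((hE' x hx).sub (hE' y hy)).abs
      (Eventually.of_forall fun n => (hlip (φ n)).dist_le_mul x hx y hy)
  have hz0 : E' 0 = 0 := tendsto_nhds_unique (hE' 0 h0)
    (by simp [hE0 _ (hε _) (hεK _)])
  have hz1 : E' 1 = 0 := tendsto_nhds_unique (hE' 1 (right_mem_Icc.2 zero_le_one))
    (by simp [hE1 _ (hε _) (hεK _)])
  have hcont : ContinuousOn E' (Icc 0 1) :=
    (LipschitzOnWith.of_dist_le_mul (K := ⟨K, hK.le⟩) hlim1).continuousOn
  have hbd : ∀ x ∈ Icc (0 : ℝ) 1, E' x ≤ K := fun x hx => by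
    have := hlim1 x hx 0 h0
    rw [hz0, sub_zero, sub_zero, abs_of_nonneg hx.1] at this
    nlinarith [le_abs_self (E' x), hx.2]
  have hrhs : ContinuousOn (fun u => -γ' * g u * sqrtReg K 0 (E' u) - f u) (Icc 0 1) := by
    have h1 : ContinuousOn (fun u => sqrtReg K 0 (E' u)) (Icc 0 1) :=
      (continuous_sqrtReg K).comp_continuousOn (continuousOn_const.prodMk hcont)
    exact ((continuousOn_const.mul hg.continuousOn).mul h1).sub hf.continuousOn
  have hint : ∀ x ∈ Icc (0 : ℝ) 1, E' x = ∫ u in 0..x, (-γ' * g u * sqrtReg K 0 (E' u) - f u) := by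
    intro x hx
    have hsub : Icc 0 x ⊆ Icc (0 : ℝ) 1 := Icc_subset_Icc_right hx.2
    have hrn : ∀ n, ContinuousOn
        (fun u => -γ (ε n) * g u * sqrtReg K (ε n) (E (ε n) u) - f u) (Icc 0 x) := fun n => by
      have h1 : ContinuousOn (fun u => sqrtReg K (ε n) (E (ε n) u)) (Icc 0 1) :=
        (continuous_sqrtReg K).comp_continuousOn (continuousOn_const.prodMk (hlip n).continuousOn)
      exact (((continuousOn_const.mul hg.continuousOn).mul h1).sub hf.continuousOn).mono hsub
    have heq : ∀ n, E (ε n) x =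
        ∫ u in 0..x, (-γ (ε n) * g u * sqrtReg K (ε n) (E (ε n) u) - f u) := fun n => by
      rw [intervalIntegral.integral_eq_sub_of_hasDeriv_right_of_le hx.1
        ((hlip n).continuousOn.mono hsub) (fun u hu => ?_)
        ((hrn n).intervalIntegrable_of_Icc hx.1), hE0 _ (hε n) (hεK n), sub_zero]
      exact ((hE _ (hε n) (hεK n)).hasDerivWithinAt_Ici
        ⟨hu.1.le, hu.2.trans_le hx.2⟩).Ioi_of_Ici
    refine tendsto_nhds_unique (hE' x hx) ?_
    simp_rw [heq]
    refine intervalIntegral.tendsto_integral_filter_of_dominated_convergence (fun _ => K)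
      (Eventually.of_forall fun n => ?_) (Eventually.of_forall fun n => ?_)
      intervalIntegrable_const ?_
    · rw [uIoc_of_le hx.1]
      exact ((hrn _).mono Ioc_subset_Icc_self).aestronglyMeasurable measurableSet_Ioc
    · refine Eventually.of_forall fun u hu => ?_
      rw [uIoc_of_le hx.1] at hu
      exact (abs_regEnergy_rhs_le (hγ _ (hε _) (hεK _)) hG hM (hsub (Ioc_subset_Icc_self hu)) _).trans hRK
    · refine Eventually.of_forall fun u hu => ?_
      rw [uIoc_of_le hx.1] at hu
      have h1 := ((continuous_sqrtReg K).tendsto (0, E' u)).comp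
        ((hεlim.comp hφ.tendsto_atTop).prodMk_nhds (hE' u (hsub (Ioc_subset_Icc_self hu))))
      exact ((hγ'.neg.mul_const _).mul h1).sub_const _
  refine ⟨γ', E', hz0, hz1, hcont, fun u hu => ?_⟩
  have hs : sqrtReg K 0 (E' u) = √(2 * max (E' u) 0) := by
    rw [sqrtReg, min_eq_left (max_le (hbd u (Ioo_subset_Icc_self hu)) hK.le)]
  rw [← hs]
  have hnhds : Icc (0 : ℝ) 1 ∈ 𝓝 u := Icc_mem_nhds hu.1 hu.2
  have hd := intervalIntegral.integral_hasDerivAt_right (a := 0) (b := u)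
    ((hrhs.mono (Icc_subset_Icc_right hu.2.le)).intervalIntegrable_of_Icc hu.1.le)
    (hrhs.stronglyMeasurableAtFilter_nhdsWithin measurableSet_Icc u |>.filter_mono
      (by rw [nhdsWithin_eq_nhds.2 hnhds]))
    (hrhs.continuousAt hnhds)
  exact hd.congr_of_eventuallyEq (by filter_upwards [hnhds] with x hx using hint x hx)

/-- Existence of a profile. The energy found above is nonnegative by the sign principle, and
positive because at an interior zero its derivative would be `-f`; at `α`, where `f` vanishes,
positivity comes from the monotonicity of the energy on the side of `α` selected by the sign of `γ`. -/
theorem exists_isProfile {f g : ℝ → ℝ} {α : ℝ} (hf : Continuous f) (hg : Continuous g)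
    (hgpos : ∀ u ∈ Icc (0 : ℝ) 1, 0 < g u) (hα : α ∈ Ioo (0 : ℝ) 1)
    (hneg : ∀ u ∈ Ioo 0 α, f u < 0) (hpos : ∀ u ∈ Ioo α 1, 0 < f u) :
    ∃ γ Q, IsProfile f g γ Q := by
  obtain ⟨γ, E, hE0, hE1, hcont, hE⟩ := exists_energy hf hg hgpos hα hneg hpos
  have hL := nonneg_of_hasDerivAt_nonneg_of_neg (hcont.mono (Icc_subset_Icc_right hα.2.le))
    hE0.ge (fun u hu hlt => ⟨_, by
      rw [max_eq_right hlt.le]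
      simpa using (hneg u hu).le, hE u ⟨hu.1, hu.2.trans hα.2⟩⟩)
  have hR := nonpos_of_hasDerivAt_nonneg_of_pos (hcont.mono (Icc_subset_Icc_left hα.1.le)).neg
    (by simp [hE1]) (fun u hu hlt => ⟨_, by
      have : E u ≤ 0 := by simpa using hlt.le
      rw [max_eq_right this]
      simpa using (hpos u hu).le, (hE u ⟨hα.1.trans hu.1, hu.2⟩).neg⟩)
  have hnn : ∀ u ∈ Icc (0 : ℝ) 1, 0 ≤ E u := fun u hu => by
    rcases le_total u α with h | h
    · exact hL u ⟨hu.1, h⟩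
    · simpa using hR u ⟨h, hu.2⟩
  have hne : ∀ u ∈ Ioo (0 : ℝ) 1, f u ≠ 0 → 0 < E u := fun u hu hfu => by
    refine (hnn u (Ioo_subset_Icc_self hu)).lt_of_ne fun h => hfu ?_
    have hmin : IsLocalMin E u := by
      filter_upwards [Icc_mem_nhds hu.1 hu.2] with x hx
      rw [← h]
      exact hnn x hx
    simpa [← h] using hmin.hasDerivAt_eq_zero (hE u hu)
  have hEα : 0 < E α := by
    rcases le_total γ 0 with hγ | hγ
    · have hmono : MonotoneOn E (Icc 0 α) := by
        refine monotoneOn_of_hasDerivWithinAt_nonneg (convex_Icc _ _)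
          (hcont.mono (Icc_subset_Icc_right hα.2.le)) ?_ ?_
          (f' := fun u => -γ * g u * √(2 * max (E u) 0) - f u) <;> rw [interior_Icc] <;>
          intro u hu
        · exact (hE u ⟨hu.1, hu.2.trans hα.2⟩).hasDerivWithinAt
        · have := hgpos u ⟨hu.1.le, (hu.2.trans hα.2).le⟩
          have := mul_nonneg (mul_nonneg (neg_nonneg.2 hγ) this.le)
            (Real.sqrt_nonneg (2 * max (E u) 0))
          linarith [hneg u hu]
      have hh : α / 2 ∈ Ioo 0 α := ⟨by linarith [hα.1], by linarith [hα.1]⟩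
      exact (hne (α / 2) ⟨hh.1, hh.2.trans hα.2⟩ (hneg _ hh).ne).trans_le
        (hmono (Ioo_subset_Icc_self hh) (right_mem_Icc.2 hα.1.le) hh.2.le)
    · have hmono : AntitoneOn E (Icc α 1) := by
        refine antitoneOn_of_hasDerivWithinAt_nonpos (convex_Icc _ _)
          (hcont.mono (Icc_subset_Icc_left hα.1.le)) ?_ ?_
          (f' := fun u => -γ * g u * √(2 * max (E u) 0) - f u) <;> rw [interior_Icc] <;>
          intro u hu
        · exact (hE u ⟨hα.1.trans hu.1, hu.2⟩).hasDerivWithinAt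
        · have := hgpos u ⟨(hα.1.trans hu.1).le, hu.2.le⟩
          have := mul_nonneg (mul_nonneg hγ this.le)
            (Real.sqrt_nonneg (2 * max (E u) 0))
          linarith [hpos u hu]
      have hh : (α + 1) / 2 ∈ Ioo α 1 := ⟨by linarith [hα.2], by linarith [hα.2]⟩
      exact (hne _ ⟨hα.1.trans hh.1, hh.2⟩ (hpos _ hh).ne').trans_le
        (hmono (left_mem_Icc.2 hα.2.le) (Ioo_subset_Icc_self hh) hh.1.le)
  have hEpos : ∀ u ∈ Ioo (0 : ℝ) 1, 0 < E u := fun u hu => by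
    rcases lt_trichotomy u α with h | rfl | h
    · exact hne u hu (hneg u ⟨hu.1, h⟩).ne
    · exact hEα
    · exact hne u hu (hpos u ⟨h, hu.2⟩).ne'
  refine ⟨γ, fun u => √(2 * E u), (continuousOn_const.mul hcont).sqrt, by simp [hE0],
    by simp [hE1], fun u hu => Real.sqrt_pos.2 (by linarith [hEpos u hu]), fun u hu => ?_⟩
  have hp := hEpos u hu
  have hp' : 0 < √(2 * E u) := Real.sqrt_pos.2 (by linarith)
  refine (((hE u hu).const_mul 2).sqrt (by linarith : (0:ℝ) < 2 * E u).ne').congr_deriv ?_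
  rw [max_eq_left hp.le]
  field_simp

/-! ### Travelling waves as solutions of ordinary differential equations -/

/-- The profile equations of a front with speed `c`, solved for the derivatives (which needs
`1 - c ^ 2 * τ ≠ 0`), with the limits at infinity. For `τ = 0` these are the profile equations of a
front of the parabolic equation, with `V = U'`. -/
structure IsFrontODE (τ : ℝ) (f : ℝ → ℝ) (c : ℝ) (U V : ℝ → ℝ) : Prop where
  dU : ∀ ξ, HasDerivAt U ((V ξ + c * τ * f (U ξ)) / (1 - c ^ 2 * τ)) ξ
  dV : ∀ ξ, HasDerivAt V ((-c * V ξ - f (U ξ)) / (1 - c ^ 2 * τ)) ξ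
  U_bot : Tendsto U atBot (𝓝 0)
  V_bot : Tendsto V atBot (𝓝 0)
  U_top : Tendsto U atTop (𝓝 1)
  V_top : Tendsto V atTop (𝓝 0)

theorem IsBistable.zero_left {f : ℝ → ℝ} (hf : IsBistable f) : f 0 = 0 := by
  obtain ⟨-, α, hα, h0, -⟩ := hf
  exact h0

theorem isRelaxationFront_iff {τ : ℝ} {f : ℝ → ℝ} {c : ℝ} {U V : ℝ → ℝ}
    (hk : 0 < 1 - c ^ 2 * τ) : IsRelaxationFront τ f c U V ↔ IsFrontODE τ f c U V := by
  have chain : ∀ {F : ℝ → ℝ} {d x t : ℝ}, HasDerivAt F d (x - c * t) →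
      HasDerivAt (fun s => F (x - c * s)) (-c * d) t := by
    intro F d x t h
    have := h.comp t (((hasDerivAt_id t).const_mul c).const_sub x)
    exact this.congr_deriv (by ring)
  have chainx : ∀ {F : ℝ → ℝ} {d x t : ℝ}, HasDerivAt F d (x - c * t) →
      HasDerivAt (fun y => F (y - c * t)) d x := by
    intro F d x t h
    have := h.comp x ((hasDerivAt_id x).sub_const (c * t))
    exact this.congr_deriv (by ring)
  constructor
  · rintro ⟨h, h1, h2, h3, h4⟩
    have key : ∀ ξ, HasDerivAt U ((V ξ + c * τ * f (U ξ)) / (1 - c ^ 2 * τ)) ξ ∧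
        HasDerivAt V ((-c * V ξ - f (U ξ)) / (1 - c ^ 2 * τ)) ξ := by
      intro ξ
      obtain ⟨hU, -, hV, -, e1, e2⟩ := h ξ 0
      simp only [mul_zero, sub_zero] at hU hV e1 e2
      have hU' : HasDerivAt U (deriv U ξ) (ξ - c * 0) := by simpa using hU.hasDerivAt
      have hV' : HasDerivAt V (deriv V ξ) (ξ - c * 0) := by simpa using hV.hasDerivAt
      rw [(chain hU').deriv] at e1
      rw [(chain hV').deriv] at e2
      refine ⟨hU.hasDerivAt.congr_deriv ?_, hV.hasDerivAt.congr_deriv ?_⟩ <;>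
        rw [eq_div_iff hk.ne']
      · linear_combination c * τ * e1 - e2
      · linear_combination c * e2 - e1
    exact ⟨fun ξ => (key ξ).1, fun ξ => (key ξ).2, h1, h2, h3, h4⟩
  · intro h
    refine ⟨fun x t => ?_, h.U_bot, h.V_bot, h.U_top, h.V_top⟩
    have hU := h.dU (x - c * t)
    have hV := h.dV (x - c * t)
    refine ⟨(chainx hU).differentiableAt, (chain hU).differentiableAt,
      (chainx hV).differentiableAt, (chain hV).differentiableAt, ?_, ?_⟩
    · rw [(chain hU).deriv, (chainx hV).deriv]
      field_simp
      ring
    · rw [(chain hV).deriv, (chainx hU).deriv]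
      have e1 := div_mul_cancel₀ (V (x - c * t) + c * τ * f (U (x - c * t))) hk.ne'
      have e2 := div_mul_cancel₀ (-c * V (x - c * t) - f (U (x - c * t))) hk.ne'
      apply mul_right_cancel₀ hk.ne'
      linear_combination -c * τ * e2 - e1

/-- If `U` converges and `(U' + c U)'` tends to zero, then `U'` tends to zero: on each unit interval
`U'` is small at some point by the mean value theorem, and it varies little. -/
theorem tendsto_deriv_zero_atTop {U V r : ℝ → ℝ} {c a : ℝ} (hU : ∀ x, HasDerivAt U (V x) x)
    (hy : ∀ x, HasDerivAt (fun x => V x + c * U x) (r x) x) (hlim : Tendsto U atTop (𝓝 a))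
    (hr : Tendsto r atTop (𝓝 0)) : Tendsto V atTop (𝓝 0) := by
  rw [Metric.tendsto_atTop] at *
  intro ε hε
  have hpos : 0 < ε / (4 + 2 * |c|) := by positivity
  obtain ⟨N₁, hN₁⟩ := hlim _ hpos
  obtain ⟨N₂, hN₂⟩ := hr _ hpos
  set e := ε / (4 + 2 * |c|) with he
  have hee : e * (4 + 2 * |c|) = ε := div_mul_cancel₀ _ (by positivity)
  refine ⟨max N₁ N₂, fun x hx => ?_⟩
  have hx1 := (le_max_left _ _).trans hx
  have hx2 := (le_max_right _ _).trans hx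
  obtain ⟨θ, hθ, hθe⟩ := exists_hasDerivAt_eq_slope U V (show x < x + 1 by linarith)
    (fun y _ => (hU y).continuousAt.continuousWithinAt) (fun y _ => hU y)
  obtain ⟨η, hη, hηe⟩ := exists_hasDerivAt_eq_slope (fun x => V x + c * U x) r hθ.1
    (fun y _ => (hy y).continuousAt.continuousWithinAt) (fun y _ => hy y)
  have hθx : 0 < θ - x := sub_pos.2 hθ.1
  rw [eq_div_iff hθx.ne'] at hηe
  rw [show x + 1 - x = 1 by ring, div_one] at hθe
  have h1 := hN₁ x hx1
  have h2 := hN₁ (x + 1) (by linarith)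
  have h3 := hN₁ θ (by linarith [hθ.1])
  have h4 := hN₂ η (by linarith [hη.1])
  rw [Real.dist_eq] at *
  rw [sub_zero] at *
  have e1 : V x = (U (x + 1) - a) - (U x - a) + c * ((U θ - a) - (U x - a)) - r η * (θ - x) := by
    rw [hηe, hθe]; ring
  have e2 : |c * ((U θ - a) - (U x - a))| ≤ |c| * (e + e) := by
    rw [abs_mul]
    exact mul_le_mul_of_nonneg_left ((abs_sub _ _).trans (by linarith)) (abs_nonneg _)
  have e3 : |r η * (θ - x)| ≤ e * 1 := by
    rw [abs_mul, abs_of_pos hθx]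
    exact mul_le_mul h4.le (by linarith [hθ.2]) hθx.le hpos.le
  have e4 : |(U (x + 1) - a) - (U x - a)| ≤ e + e := (abs_sub _ _).trans (by linarith)
  calc |V x| ≤ (e + e) + |c| * (e + e) + e * 1 := by
        rw [e1]
        exact (abs_sub _ _).trans (add_le_add ((abs_add_le _ _).trans (add_le_add e4 e2)) e3)
    _ < ε := by linarith

theorem tendsto_deriv_zero_atBot {U V r : ℝ → ℝ} {c a : ℝ} (hU : ∀ x, HasDerivAt U (V x) x)
    (hy : ∀ x, HasDerivAt (fun x => V x + c * U x) (r x) x) (hlim : Tendsto U atBot (𝓝 a))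
    (hr : Tendsto r atBot (𝓝 0)) : Tendsto V atBot (𝓝 0) := by
  have h := tendsto_deriv_zero_atTop (U := fun x => U (-x)) (V := fun x => -V (-x))
    (r := fun x => r (-x)) (c := -c) (a := a)
    (fun x => ((hU (-x)).comp x (hasDerivAt_neg x)).congr_deriv (by ring))
    (fun x => by
      have := ((hy (-x)).comp x (hasDerivAt_neg x)).fun_neg.congr_deriv
        (show -(r (-x) * -1) = r (-x) by ring)
      refine this.congr_of_eventuallyEq (Eventually.of_forall fun y => ?_)
      simp only [Function.comp_apply]
      ring)
    (hlim.comp tendsto_neg_atTop_atBot) (hr.comp tendsto_neg_atTop_atBot)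
  simpa [Function.comp_def] using (h.comp tendsto_neg_atBot_atTop).neg

theorem IsParabolicFront.isFrontODE {f : ℝ → ℝ} {c : ℝ} {U : ℝ → ℝ} (hf : Continuous f)
    (hf0 : f 0 = 0) (hf1 : f 1 = 0) (h : IsParabolicFront f c U) :
    IsFrontODE 0 f c U (deriv U) := by
  obtain ⟨h, hbot, htop⟩ := h
  have key : ∀ ξ, HasDerivAt U (deriv U ξ) ξ ∧
      HasDerivAt (deriv U) (-c * deriv U ξ - f (U ξ)) ξ := by
    intro ξ
    obtain ⟨h1, h2, -, e⟩ := h ξ 0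
    simp only [mul_zero, sub_zero] at h1 h2 e
    have h1' : HasDerivAt U (deriv U ξ) (ξ - c * 0) := by simpa using h1.hasDerivAt
    have := h1'.comp 0 (((hasDerivAt_id (0 : ℝ)).const_mul c).const_sub ξ)
    simp only [Function.comp_def, id] at this
    rw [this.deriv] at e
    exact ⟨h1.hasDerivAt, h2.hasDerivAt.congr_deriv (by linarith)⟩
  have hy : ∀ x, HasDerivAt (fun x => deriv U x + c * U x) (-f (U x)) x := fun x =>
    ((key x).2.fun_add ((key x).1.const_mul c)).congr_deriv (by ring)
  refine ⟨fun ξ => ?_, fun ξ => ?_, hbot, ?_, htop, ?_⟩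
  · simpa using (key ξ).1
  · simpa using (key ξ).2
  · refine tendsto_deriv_zero_atBot (fun x => (key x).1) hy hbot ?_
    simpa [hf0] using ((hf.tendsto 0).comp hbot).neg
  · refine tendsto_deriv_zero_atTop (fun x => (key x).1) hy htop ?_
    simpa [hf1] using ((hf.tendsto 1).comp htop).neg

theorem IsFrontODE.isParabolicFront {f : ℝ → ℝ} {c : ℝ} {U V : ℝ → ℝ}
    (h : IsFrontODE 0 f c U V) : IsParabolicFront f c U := by
  have hU : ∀ x, HasDerivAt U (V x) x := fun x => by simpa using h.dU x
  have hV : ∀ x, HasDerivAt V (-c * V x - f (U x)) x := fun x => by simpa using h.dV x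
  refine ⟨fun x t => ?_, h.U_bot, h.U_top⟩
  have shift : ∀ {F F' : ℝ → ℝ}, (∀ x, HasDerivAt F (F' x) x) → ∀ y,
      HasDerivAt (fun y => F (y - c * t)) (F' (y - c * t)) y := fun hF y =>
    ((hF (y - c * t)).comp y ((hasDerivAt_id y).sub_const (c * t))).congr_deriv (by ring)
  have hd : deriv (fun y => U (y - c * t)) = fun y => V (y - c * t) :=
    funext fun y => (shift hU y).deriv
  have ht : HasDerivAt (fun s => U (x - c * s)) (-c * V (x - c * t)) t :=
    ((hU (x - c * t)).comp t (((hasDerivAt_id t).const_mul c).const_sub x)).congr_deriv (by ring)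
  rw [hd]
  refine ⟨(shift hU x).differentiableAt, (shift hV x).differentiableAt, ht.differentiableAt, ?_⟩
  rw [(shift hV x).deriv, ht.deriv]
  ring

/-! ### Qualitative properties of fronts -/

namespace IsFrontODE

variable {τ c : ℝ} {f U V : ℝ → ℝ}

theorem reflect (h : IsFrontODE τ f c U V) :
    IsFrontODE τ (fun u => -f (1 - u)) (-c) (fun ξ => 1 - U (-ξ)) (fun ξ => V (-ξ)) where
  dU ξ := ((h.dU (-ξ)).comp ξ (hasDerivAt_neg ξ)).const_sub 1 |>.congr_deriv (by
    simp only [sub_sub_cancel, neg_sq]; ring)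
  dV ξ := ((h.dV (-ξ)).comp ξ (hasDerivAt_neg ξ)).congr_deriv (by
    simp only [sub_sub_cancel, neg_sq]; ring)
  U_bot := by simpa using (h.U_top.comp tendsto_neg_atBot_atTop).const_sub 1
  V_bot := h.V_top.comp tendsto_neg_atBot_atTop
  U_top := by simpa using (h.U_bot.comp tendsto_neg_atTop_atBot).const_sub 1
  V_top := h.V_bot.comp tendsto_neg_atTop_atBot

theorem continuous_U (h : IsFrontODE τ f c U V) : Continuous U :=
  continuous_iff_continuousAt.2 fun ξ => (h.dU ξ).continuousAt

theorem continuous_V (h : IsFrontODE τ f c U V) : Continuous V :=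
  continuous_iff_continuousAt.2 fun ξ => (h.dV ξ).continuousAt

/-- The second-order form of the front equations, `k U'' + c (1 - τ f'(U)) U' + f(U) = 0` with
`k = 1 - c ^ 2 τ`. The slope `U'` is written in terms of `U` and `V`. -/
theorem hasDerivAt_slope (h : IsFrontODE τ f c U V) (hf : ContDiff ℝ 1 f)
    (hk : 0 < 1 - c ^ 2 * τ) (ξ : ℝ) :
    HasDerivAt (fun ξ => (V ξ + c * τ * f (U ξ)) / (1 - c ^ 2 * τ))
      (-(c * (1 - τ * deriv f (U ξ)) * ((V ξ + c * τ * f (U ξ)) / (1 - c ^ 2 * τ)) + f (U ξ)) /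
        (1 - c ^ 2 * τ)) ξ := by
  have hfU : HasDerivAt (fun ξ => f (U ξ)) _ ξ :=
    (hf.differentiable one_ne_zero (U ξ)).hasDerivAt.comp ξ (h.dU ξ)
  refine (((h.dV ξ).fun_add (hfU.const_mul (c * τ))).div_const _).congr_deriv ?_
  congr 1
  have e1 := div_mul_cancel₀ (V ξ + c * τ * f (U ξ)) hk.ne'
  have e2 := div_mul_cancel₀ (-c * V ξ - f (U ξ)) hk.ne'
  apply mul_right_cancel₀ hk.ne'
  linear_combination e2 + c * e1

/-- At a negative minimum of `U` the second-order equation would give `U'' < 0`. -/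
theorem nonneg (h : IsFrontODE τ f c U V) (hf : IsBistable f) (hk : 0 < 1 - c ^ 2 * τ) (ξ : ℝ) :
    0 ≤ U ξ := by
  by_contra! hneg
  obtain ⟨z, hz⟩ := h.continuous_U.exists_forall_le' ξ (by
    rw [cocompact_eq_atBot_atTop]
    refine eventually_sup.2 ⟨?_, ?_⟩
    · filter_upwards [h.U_bot.eventually_const_lt hneg] with x hx using hx.le
    · filter_upwards [h.U_top.eventually_const_lt (hneg.trans one_pos)] with x hx using hx.le)
  have hzn : U z < 0 := (hz ξ).trans_lt hneg
  have hW := (show IsLocalMin U z from Eventually.of_forall hz).hasDerivAt_eq_zero (h.dU z)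
  have hd := h.hasDerivAt_slope hf.1 hk z
  rw [hW, mul_zero, zero_add] at hd
  obtain ⟨-, α, -, -, -, -, -, -, -, hp, -⟩ := hf
  obtain ⟨y, hy⟩ := (eventually_lt_right_of_deriv_neg h.dU hW hd
    (div_neg_of_neg_of_pos (neg_neg_of_pos (hp _ (Or.inl hzn))) hk)).exists
  exact absurd (hz y) (not_le.2 hy)

theorem mem_Icc (h : IsFrontODE τ f c U V) (hf : IsBistable f) (hk : 0 < 1 - c ^ 2 * τ) (ξ : ℝ) :
    U ξ ∈ Icc (0 : ℝ) 1 := by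
  refine ⟨h.nonneg hf hk ξ, ?_⟩
  have := h.reflect.nonneg hf.reflect (by rwa [neg_sq]) (-ξ)
  simpa using this

/-- If `U` vanished somewhere, it would have a minimum there, so `V` would vanish too, and the front
would be the constant solution by uniqueness for the ordinary differential equation. -/
theorem pos (h : IsFrontODE τ f c U V) (hf : IsBistable f) (hk : 0 < 1 - c ^ 2 * τ) (ξ : ℝ) :
    0 < U ξ := by
  refine (h.nonneg hf hk ξ).lt_of_ne fun h0 => ?_
  have hW := (show IsLocalMin U ξ from Eventually.of_forall fun x => by
    simpa [← h0] using h.nonneg hf hk x).hasDerivAt_eq_zero (h.dU ξ)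
  have hV : V ξ = 0 := by
    rw [← h0, hf.zero_left, mul_zero, add_zero, div_eq_zero_iff] at hW
    exact hW.resolve_right hk.ne'
  obtain ⟨L, hL⟩ := (hf.1.contDiffOn (s := Icc 0 1)).exists_lipschitzOnWith one_ne_zero
    (convex_Icc 0 1) isCompact_Icc
  set k := 1 - c ^ 2 * τ with hkdef
  have hsol := ODE_solution_unique_univ (E := ℝ × ℝ)
    (v := fun _ p => ((p.2 + c * τ * f p.1) / k, (-c * p.2 - f p.1) / k))
    (s := fun _ => Icc 0 1 ×ˢ univ)
    (K := Real.toNNReal ((1 + |c * τ| * L + |c| + L) / k)) (t₀ := ξ)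
    (f := fun x => (U x, V x)) (g := fun _ => 0) (fun _ => ?_)
    (fun x => ⟨(h.dU x).prodMk (h.dV x), h.mem_Icc hf hk x, mem_univ _⟩)
    (fun x => ⟨?_, by simp⟩) (by simp [← h0, hV])
  · have : ∀ x, U x = 0 := fun x => congrArg Prod.fst (congrFun hsol x)
    have h1 := h.U_top
    rw [show U = fun _ => 0 from funext this] at h1
    exact zero_ne_one (tendsto_nhds_unique tendsto_const_nhds h1)
  · refine LipschitzOnWith.of_dist_le' fun p hp q hq => ?_
    have h1 := hL.dist_le_mul p.1 hp.1 q.1 hq.1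
    have h2 : dist p.1 q.1 ≤ dist p q := le_max_left _ _
    have h3 : dist p.2 q.2 ≤ dist p q := le_max_right _ _
    have h4 : dist (f p.1) (f q.1) ≤ L * dist p q :=
      h1.trans (mul_le_mul_of_nonneg_left h2 L.2)
    have h5 : 0 ≤ dist p q := dist_nonneg
    generalize dist p q = D at *
    rw [Real.dist_eq] at h3 h4
    have hL0 : 0 ≤ (L : ℝ) := L.coe_nonneg
    rw [Prod.dist_eq, Real.dist_eq, Real.dist_eq, ← sub_div, ← sub_div, abs_div, abs_div,
      abs_of_pos hk, div_mul_eq_mul_div]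
    refine max_le (div_le_div_of_nonneg_right ?_ hk.le) (div_le_div_of_nonneg_right ?_ hk.le)
    · calc |p.2 + c * τ * f p.1 - (q.2 + c * τ * f q.1)|
          = |(p.2 - q.2) + c * τ * (f p.1 - f q.1)| := by ring_nf
        _ ≤ D + |c * τ| * (L * D) := by
            refine (abs_add_le _ _).trans (add_le_add h3 ?_)
            rw [abs_mul]; gcongr
        _ ≤ (1 + |c * τ| * L + |c| + L) * D := by
            have := mul_nonneg (abs_nonneg c) h5
            have := mul_nonneg hL0 h5
            nlinarith
    · calc |-c * p.2 - f p.1 - (-c * q.2 - f q.1)|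
          = |-c * (p.2 - q.2) - (f p.1 - f q.1)| := by ring_nf
        _ ≤ |c| * D + L * D := by
            refine (abs_sub _ _).trans (add_le_add ?_ h4)
            rw [abs_mul, abs_neg]; gcongr
        _ ≤ (1 + |c * τ| * L + |c| + L) * D := by
            have := mul_nonneg (mul_nonneg (abs_nonneg (c * τ)) hL0) h5
            nlinarith
  · have := hasDerivAt_const x (0 : ℝ × ℝ)
    exact this.congr_deriv (by ext <;> simp [hf.zero_left])

theorem mem_Ioo (h : IsFrontODE τ f c U V) (hf : IsBistable f) (hk : 0 < 1 - c ^ 2 * τ) (ξ : ℝ) :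
    U ξ ∈ Ioo (0 : ℝ) 1 := by
  refine ⟨h.pos hf hk ξ, ?_⟩
  have := h.reflect.pos hf.reflect (by rwa [neg_sq]) (-ξ)
  simpa using this

theorem slope_bot (h : IsFrontODE τ f c U V) (hf : Continuous f) (hf0 : f 0 = 0) :
    Tendsto (fun ξ => (V ξ + c * τ * f (U ξ)) / (1 - c ^ 2 * τ)) atBot (𝓝 0) := by
  have h1 := (hf.tendsto 0).comp h.U_bot
  rw [hf0] at h1
  simpa using (h.V_bot.add (h1.const_mul (c * τ))).div_const (1 - c ^ 2 * τ)

/-- For `c ≤ 0` the front has no critical point. The energy `k U' ^ 2 / 2 + ∫ u in 0..U, f u` is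
nondecreasing and tends to `0` at `-∞`, so at a critical point `∫ u in 0..U, f u ≥ 0`, which forces
`U > α` and `U'' < 0`. Beyond such a strict local maximum `U` would have a minimum on its way to
`1`, which is again a critical point. -/
theorem slope_ne_zero_of_nonpos (h : IsFrontODE τ f c U V) (hf : IsBistable f)
    (hk : 0 < 1 - c ^ 2 * τ) (hg : ∀ u ∈ Icc (0 : ℝ) 1, 0 < 1 - τ * deriv f u) (hc : c ≤ 0)
    (ξ : ℝ) : (V ξ + c * τ * f (U ξ)) / (1 - c ^ 2 * τ) ≠ 0 := by
  set W := fun ξ => (V ξ + c * τ * f (U ξ)) / (1 - c ^ 2 * τ) with hW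
  have hdW := h.hasDerivAt_slope hf.1 hk
  have hcont := hf.1.continuous
  -- the energy is nondecreasing
  set H : ℝ → ℝ := fun ξ => (1 - c ^ 2 * τ) * W ξ ^ 2 / 2 + ∫ u in 0..U ξ, f u with hH
  have hdH : ∀ x, HasDerivAt H (-c * (1 - τ * deriv f (U x)) * W x ^ 2) x := by
    intro x
    have h1 := (hcont.integral_hasStrictDerivAt 0 (U x)).hasDerivAt.comp x (h.dU x)
    have h2 := (((hdW x).fun_pow 2).const_mul (1 - c ^ 2 * τ)).div_const 2
    refine (h2.fun_add h1).congr_deriv ?_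
    simp only [hW]
    push_cast
    field_simp
    ring
  have hmono : Monotone H := monotone_of_hasDerivAt_nonneg hdH fun x =>
    mul_nonneg (mul_nonneg (neg_nonneg.2 hc) (hg _ (h.mem_Icc hf hk x)).le) (sq_nonneg _)
  have hlim : Tendsto H atBot (𝓝 0) := by
    have h1 := (h.slope_bot hcont hf.zero_left).pow 2 |>.const_mul (1 - c ^ 2 * τ) |>.div_const 2
    have hc : Continuous fun x => ∫ u in 0..x, f u :=
      intervalIntegral.continuous_primitive (fun a b => hcont.intervalIntegrable a b) 0
    have h2 := (hc.tendsto 0).comp h.U_bot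
    simpa [Function.comp_def] using h1.add h2
  have hH0 : ∀ x, 0 ≤ H x := fun x => hmono.le_of_tendsto hlim x
  obtain ⟨-, α, hα, -, hα0, -, -, -, -, hp, hn⟩ := id hf
  have hcrit : ∀ x, W x = 0 → 0 < f (U x) := by
    intro x hx
    have hU := h.mem_Ioo hf hk x
    refine hp _ (Or.inr ⟨?_, hU.2⟩)
    by_contra! hle
    have h1 := hH0 x
    simp only [hH, hx] at h1
    have h2 : 0 < ∫ u in 0..U x, -f u :=
      intervalIntegral.intervalIntegral_pos_of_pos_on (hcont.neg.intervalIntegrable _ _)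
        (fun u hu => neg_pos.2 (hn u (Or.inl ⟨hu.1, hu.2.trans_le hle⟩))) hU.1
    rw [intervalIntegral.integral_neg] at h2
    norm_num at h1
    linarith
  have hdec : ∀ x, W x = 0 → ∀ᶠ y in 𝓝[>] x, U y < U x := fun x hx => by
    have hd := hdW x
    rw [show (V x + c * τ * f (U x)) / (1 - c ^ 2 * τ) = 0 from hx, mul_zero, zero_add] at hd
    exact eventually_lt_right_of_deriv_neg h.dU hx hd
      (div_neg_of_neg_of_pos (neg_neg_of_pos (hcrit x hx)) hk)
  intro hξ
  obtain ⟨y, hy, hξy⟩ := ((hdec ξ hξ).and self_mem_nhdsWithin).exists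
  obtain ⟨z, hz, hmin⟩ := (h.continuous_U.continuousOn (s := Ici ξ)).exists_isMinOn' isClosed_Ici
    (show y ∈ Ici ξ from le_of_lt hξy) (by
      rw [cocompact_eq_atBot_atTop, inf_sup_right]
      refine eventually_sup.2 ⟨?_, ?_⟩
      · rw [eventually_inf_principal]
        filter_upwards [eventually_lt_atBot ξ] with x hx hx'
        exact absurd hx (not_lt.2 hx')
      · refine Eventually.filter_mono inf_le_left ?_
        filter_upwards [h.U_top.eventually_const_lt (h.mem_Ioo hf hk y).2] with x hx using hx.le)
  have hzy : U z ≤ U y := hmin (show y ∈ Ici ξ from le_of_lt hξy)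
  have hξz : ξ < z := lt_of_le_of_ne hz fun e => by
    rw [← e] at hzy
    exact absurd hy (not_lt.2 hzy)
  have hloc : IsLocalMin U z := by
    filter_upwards [Ioi_mem_nhds hξz] with x hx using hmin (mem_Ici.2 (le_of_lt hx))
  obtain ⟨x, hx, hzx⟩ := ((hdec z (hloc.hasDerivAt_eq_zero (h.dU z))).and self_mem_nhdsWithin).exists
  exact absurd (hmin (show x ∈ Ici ξ from (hξz.trans hzx).le)) (not_le.2 hx)

theorem slope_pos (h : IsFrontODE τ f c U V) (hf : IsBistable f)
    (hk : 0 < 1 - c ^ 2 * τ) (hg : ∀ u ∈ Icc (0 : ℝ) 1, 0 < 1 - τ * deriv f u) (ξ : ℝ) :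
    0 < (V ξ + c * τ * f (U ξ)) / (1 - c ^ 2 * τ) := by
  have hne : ∀ x, (V x + c * τ * f (U x)) / (1 - c ^ 2 * τ) ≠ 0 := by
    intro x
    rcases le_total c 0 with hc | hc
    · exact h.slope_ne_zero_of_nonpos hf hk hg hc x
    · have := h.reflect.slope_ne_zero_of_nonpos hf.reflect (by rwa [neg_sq])
        (fun u hu => by
          rw [deriv_reflect]
          exact hg (1 - u) ⟨by linarith [hu.2], by linarith [hu.1]⟩) (by linarith) (-x)
      simpa using this
  by_contra! hle
  have hcW : Continuous fun ξ => (V ξ + c * τ * f (U ξ)) / (1 - c ^ 2 * τ) :=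
    (h.continuous_V.add (continuous_const.mul (hf.1.continuous.comp h.continuous_U))).div_const _
  have hall : ∀ x, (V x + c * τ * f (U x)) / (1 - c ^ 2 * τ) ≤ 0 := by
    intro x
    by_contra! hlt
    obtain ⟨y, hy⟩ := mem_range_of_exists_le_of_exists_ge hcW ⟨ξ, hle⟩ ⟨x, hlt.le⟩
    exact hne y hy
  have hanti : Antitone U := antitone_of_hasDerivAt_nonpos h.dU hall
  have := hanti.ge_of_tendsto h.U_bot ξ
  linarith [(h.mem_Ioo hf hk ξ).1]

theorem strictMono (h : IsFrontODE τ f c U V) (hf : IsBistable f)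
    (hk : 0 < 1 - c ^ 2 * τ) (hg : ∀ u ∈ Icc (0 : ℝ) 1, 0 < 1 - τ * deriv f u) :
    StrictMono U :=
  strictMono_of_hasDerivAt_pos h.dU (h.slope_pos hf hk hg)

/-- At a critical point of `V` one has `V = U' > 0`, so `V` has no nonpositive minimum. -/
theorem pos_V (h : IsFrontODE τ f c U V) (hf : IsBistable f)
    (hk : 0 < 1 - c ^ 2 * τ) (hg : ∀ u ∈ Icc (0 : ℝ) 1, 0 < 1 - τ * deriv f u) (ξ : ℝ) :
    0 < V ξ := by
  have hcrit : ∀ x, (-c * V x - f (U x)) / (1 - c ^ 2 * τ) = 0 → 0 < V x := by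
    intro x hx
    have hW := h.slope_pos hf hk hg x
    rw [div_eq_zero_iff, or_iff_left hk.ne'] at hx
    have : V x + c * τ * f (U x) = V x * (1 - c ^ 2 * τ) := by linear_combination -c * τ * hx
    rwa [this, mul_div_cancel_right₀ _ hk.ne'] at hW
  have hmin : ∀ z, (∀ x, V z ≤ V x) → 0 < V z := fun z hz =>
    hcrit z ((show IsLocalMin V z from Eventually.of_forall hz).hasDerivAt_eq_zero (h.dV z))
  have hnn : ∀ x, 0 ≤ V x := by
    intro x
    by_contra! hneg
    obtain ⟨z, hz⟩ := h.continuous_V.exists_forall_le' x (by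
      rw [cocompact_eq_atBot_atTop]
      refine eventually_sup.2 ⟨?_, ?_⟩
      · filter_upwards [h.V_bot.eventually_const_lt hneg] with x hx using hx.le
      · filter_upwards [h.V_top.eventually_const_lt hneg] with x hx using hx.le)
    exact absurd (hmin z hz) (not_lt.2 ((hz x).trans hneg.le))
  refine (hnn ξ).lt_of_ne fun h0 => ?_
  have := hmin ξ (fun x => h0 ▸ hnn x)
  exact absurd h0 this.ne

/-- A front is monotone, so its slope is a function of its height, and that function, scaled by
`√(1 - c ^ 2 * τ)`, is a profile. -/
theorem exists_isProfile (h : IsFrontODE τ f c U V) (hf : IsBistable f)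
    (hk : 0 < 1 - c ^ 2 * τ) (hg : ∀ u ∈ Icc (0 : ℝ) 1, 0 < 1 - τ * deriv f u) :
    ∃ Q, IsProfile f (fun u => 1 - τ * deriv f u) (c / √(1 - c ^ 2 * τ)) Q ∧
      ∀ ξ, Q (U ξ) = √(1 - c ^ 2 * τ) * ((V ξ + c * τ * f (U ξ)) / (1 - c ^ 2 * τ)) := by
  have hpos := h.slope_pos hf hk hg
  have hdW := h.hasDerivAt_slope hf.1 hk
  have hbot := h.slope_bot hf.1.continuous hf.zero_left
  have htop : Tendsto (fun ξ => (V ξ + c * τ * f (U ξ)) / (1 - c ^ 2 * τ)) atTop (𝓝 0) := by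
    have := (h.reflect.slope_bot hf.reflect.1.continuous hf.reflect.zero_left).comp
      tendsto_neg_atTop_atBot
    simpa [Function.comp_def] using this
  have hdU := h.dU
  have alg : ∀ {r k w a b : ℝ}, 0 < r → 0 < w → k = r * r →
      r * (-(c * a * w + b) / k * w⁻¹) = -(c / r) * a - b / (r * w) := by
    rintro r k w a b hr hw rfl
    field_simp
    ring
  set k := 1 - c ^ 2 * τ with hkdef
  set W := fun ξ => (V ξ + c * τ * f (U ξ)) / k with hW
  have hmono := h.strictMono hf hk hg
  have hI := h.mem_Ioo hf hk
  have himg : U '' univ = Ioo 0 1 := by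
    apply Subset.antisymm
    · rintro _ ⟨ξ, -, rfl⟩; exact hI ξ
    · intro u hu
      obtain ⟨ξ, hξ⟩ := mem_range_of_exists_le_of_exists_ge h.continuous_U
        (h.U_bot.eventually_le_const hu.1).exists (h.U_top.eventually_const_le hu.2).exists
      exact ⟨ξ, mem_univ _, hξ⟩
  obtain ⟨ψ, hψ, hψU, hdψ, -⟩ := exists_inverse_of_strictMonoOn isOpen_univ isOpen_Ioo
    (fun x _ => hdU x) (fun x _ => (hpos x).ne') (hmono.strictMonoOn _) himg
  have hsk : 0 < √k := Real.sqrt_pos.2 hk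
  set Q : ℝ → ℝ := (Ioo (0 : ℝ) 1).indicator fun u => √k * W (ψ u) with hQ
  have hQI : ∀ u ∈ Ioo (0 : ℝ) 1, Q u = √k * W (ψ u) := fun u hu => indicator_of_mem hu _
  have hQO : ∀ u, u ∉ Ioo (0 : ℝ) 1 → Q u = 0 := fun u hu => indicator_of_notMem hu _
  have hder : ∀ u ∈ Ioo (0 : ℝ) 1,
      HasDerivAt Q (-(c / √k) * (1 - τ * deriv f u) - f u / Q u) u := by
    intro u hu
    have h1 := ((hdW (ψ u)).comp u (hdψ u hu)).const_mul (√k)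
    have h2 : HasDerivAt Q _ u := h1.congr_of_eventuallyEq (by
      filter_upwards [isOpen_Ioo.mem_nhds hu] with x hx using hQI x hx)
    refine h2.congr_deriv ?_
    have hp : (0 : ℝ) < W (ψ u) := hpos (ψ u)
    rw [hQI u hu]
    have hWd : (V (ψ u) + c * τ * f u) / k = W (ψ u) := by simp only [hW, (hψ u hu).2]
    simp only [(hψ u hu).2, hWd]
    exact alg hsk hp (Real.mul_self_sqrt hk.le).symm
  -- `Q` inherits its limits at `0` and `1` from those of the slope at `-∞` and `∞`
  have small : ∀ {l : Filter ℝ}, Tendsto W l (𝓝 0) → ∀ {F : Filter ℝ},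
      (∀ s ∈ l, ∀ᶠ u in F, u ∈ Ioo (0 : ℝ) 1 → ψ u ∈ s) → Tendsto Q F (𝓝 0) := by
    intro l hl F hF
    refine Metric.tendsto_nhds.2 fun ε hε => ?_
    have h1 := hl.const_mul (√k)
    rw [mul_zero] at h1
    filter_upwards [hF _ (Metric.tendsto_nhds.1 h1 ε hε)] with u hu
    by_cases hu' : u ∈ Ioo (0 : ℝ) 1
    · rw [hQI u hu']; exact hu hu'
    · rw [hQO u hu']; simpa using hε
  have hQ0 : Q 0 = 0 := hQO 0 (by simp)
  have hQ1 : Q 1 = 0 := hQO 1 (by simp)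
  refine ⟨Q, ⟨fun u hu => ?_, hQ0, hQ1, fun u hu => ?_, hder⟩, fun ξ => ?_⟩
  · rcases hu.1.eq_or_lt with rfl | hu0
    · refine ContinuousAt.continuousWithinAt ?_
      rw [ContinuousAt, hQ0]
      refine small hbot fun s hs => ?_
      obtain ⟨b, hb⟩ := mem_atBot_sets.1 hs
      filter_upwards [Iio_mem_nhds (hI b).1] with u hub hu
      refine hb _ (le_of_lt ?_)
      rw [← hmono.lt_iff_lt, (hψ u hu).2]
      exact hub
    rcases hu.2.eq_or_lt with rfl | hu1
    · refine ContinuousAt.continuousWithinAt ?_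
      rw [ContinuousAt, hQ1]
      refine small htop fun s hs => ?_
      obtain ⟨b, hb⟩ := mem_atTop_sets.1 hs
      filter_upwards [Ioi_mem_nhds (hI b).2] with u hub hu
      refine hb _ (le_of_lt ?_)
      rw [← hmono.lt_iff_lt, (hψ u hu).2]
      exact hub
    · exact (hder u ⟨hu0, hu1⟩).continuousAt.continuousWithinAt
  · rw [hQI u hu]
    exact mul_pos hsk (hpos _)
  · rw [hQI _ (hI ξ), hψU ξ (mem_univ _)]

theorem exists_exp_bound_left (h : IsFrontODE τ f c U V) (hf : IsBistable f)
    (hk : 0 < 1 - c ^ 2 * τ) (hg : ∀ u ∈ Icc (0 : ℝ) 1, 0 < 1 - τ * deriv f u) :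
    ∃ C > 0, ∃ ν > 0, ∀ ξ ≤ 0,
      |U ξ| ≤ C * Real.exp (-ν * |ξ|) ∧ |V ξ| ≤ C * Real.exp (-ν * |ξ|) := by
  obtain ⟨Q, hQ, hQU⟩ := h.exists_isProfile hf hk hg
  have hgc : ContinuousOn (fun u => 1 - τ * deriv f u) (Icc 0 1) :=
    (continuous_const.sub (continuous_const.mul (hf.1.continuous_deriv le_rfl))).continuousOn
  obtain ⟨δ, hδ, b, hb, hδb⟩ := hQ.exists_mul_le hf hgc
  obtain ⟨B, hB, hBQ⟩ := hQ.exists_le_mul hf hgc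
  obtain ⟨L, hL, hfL⟩ := hf.exists_abs_le
  have hI := h.mem_Ioo hf hk
  have hVW : ∀ ξ, V ξ = (1 - c ^ 2 * τ) * ((V ξ + c * τ * f (U ξ)) / (1 - c ^ 2 * τ)) -
    c * τ * f (U ξ) := fun ξ => by rw [mul_div_cancel₀ _ hk.ne']; ring
  have hdU := h.dU
  set k := 1 - c ^ 2 * τ with hkdef
  have hsk : 0 < √k := Real.sqrt_pos.2 hk
  have hkk : √k * √k = k := Real.mul_self_sqrt hk.le
  obtain ⟨ξ₀, hξ₀⟩ := eventually_atBot.1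
    ((h.U_bot.eventually_le_const hb.1).and (eventually_le_atBot 0))
  set ν := δ / √k with hν
  -- `U' ≥ ν U` near `-∞`
  have hmono : MonotoneOn (fun ξ => Real.exp (-ν * ξ) * U ξ) (Iic ξ₀) := by
    have hd : ∀ ξ, HasDerivAt (fun ξ => Real.exp (-ν * ξ) * U ξ)
        (Real.exp (-ν * ξ) * ((V ξ + c * τ * f (U ξ)) / k - ν * U ξ)) ξ := fun ξ =>
      ((((hasDerivAt_id ξ).const_mul (-ν)).exp).fun_mul (hdU ξ)).congr_deriv (by
        simp only [id]; ring)
    refine monotoneOn_of_hasDerivWithinAt_nonneg (convex_Iic _)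
      (fun ξ _ => (hd ξ).continuousAt.continuousWithinAt)
      (fun ξ _ => (hd ξ).hasDerivWithinAt) fun ξ hξ => ?_
    rw [interior_Iic] at hξ
    refine mul_nonneg (Real.exp_pos _).le (sub_nonneg.2 ?_)
    have h1 := hδb (U ξ) ⟨(hI ξ).1.le, (hξ₀ ξ hξ.le).1⟩
    rw [hQU] at h1
    rw [hν, div_mul_eq_mul_div, div_le_iff₀ hsk]
    linarith
  have hν0 : 0 < ν := by positivity
  set C₀ := Real.exp (-ν * ξ₀) with hC₀
  have hU : ∀ ξ ≤ 0, U ξ ≤ C₀ * Real.exp (-ν * |ξ|) := by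
    intro ξ hξ
    rw [abs_of_nonpos hξ, hC₀, ← Real.exp_add]
    rcases le_total ξ ξ₀ with h1 | h1
    · have h2 := hmono (show ξ ∈ Iic ξ₀ from h1) (show ξ₀ ∈ Iic ξ₀ from mem_Iic.2 le_rfl) h1
      have h3 : Real.exp (-ν * ξ) * U ξ ≤ Real.exp (-ν * ξ₀) :=
        h2.trans (mul_le_of_le_one_right (Real.exp_pos _).le (hI _).2.le)
      have h4 : U ξ = Real.exp (ν * ξ) * (Real.exp (-ν * ξ) * U ξ) := by
        rw [← mul_assoc, ← Real.exp_add]; simp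
      rw [h4, show -ν * ξ₀ + -ν * -ξ = ν * ξ + -ν * ξ₀ by ring, Real.exp_add]
      gcongr
    · refine (hI ξ).2.le.trans (Real.one_le_exp ?_)
      nlinarith
  have hC₀0 : 0 < C₀ := Real.exp_pos _
  set A := √k * B + |c * τ| * L with hA
  have hA0 : 0 ≤ A := by positivity
  have hV : ∀ ξ, |V ξ| ≤ A * U ξ := by
    intro ξ
    have hu := Ioo_subset_Icc_self (hI ξ)
    rw [hVW ξ]
    refine (abs_sub _ _).trans ?_
    rw [hA, add_mul]
    refine add_le_add ?_ ?_
    · rw [← hkk, mul_assoc, hkk, ← hQU, abs_mul, abs_of_pos hsk, abs_of_pos (hQ.pos _ (hI ξ)),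
        mul_assoc]
      gcongr
      exact hBQ _ hu
    · rw [abs_mul, mul_assoc]
      gcongr
      exact hfL _ hu
  refine ⟨(1 + A) * C₀, by positivity, ν, hν0, fun ξ hξ => ⟨?_, ?_⟩⟩
  · rw [abs_of_pos (hI ξ).1, mul_assoc]
    refine (hU ξ hξ).trans (le_mul_of_one_le_left (by positivity) (by linarith))
  · refine (hV ξ).trans ?_
    rw [mul_assoc]
    exact mul_le_mul (by linarith) (hU ξ hξ) (hI ξ).1.le (by positivity)

theorem exists_exp_bound (h : IsFrontODE τ f c U V) (hf : IsBistable f)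
    (hk : 0 < 1 - c ^ 2 * τ) (hg : ∀ u ∈ Icc (0 : ℝ) 1, 0 < 1 - τ * deriv f u) :
    ∃ C > 0, ∃ ν > 0,
      (∀ ξ ≤ 0, |U ξ| ≤ C * Real.exp (-ν * |ξ|) ∧ |V ξ| ≤ C * Real.exp (-ν * |ξ|)) ∧
      (∀ ξ ≥ 0, |U ξ - 1| ≤ C * Real.exp (-ν * |ξ|) ∧ |V ξ| ≤ C * Real.exp (-ν * |ξ|)) := by
  obtain ⟨C₁, hC₁, ν₁, hν₁, h₁⟩ := h.exists_exp_bound_left hf hk hg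
  obtain ⟨C₂, hC₂, ν₂, hν₂, h₂⟩ := h.reflect.exists_exp_bound_left hf.reflect (by rwa [neg_sq])
    (fun u hu => by
      rw [deriv_reflect]
      exact hg (1 - u) ⟨by linarith [hu.2], by linarith [hu.1]⟩)
  have e₁ : ∀ ξ : ℝ, C₁ * Real.exp (-ν₁ * |ξ|) ≤ max C₁ C₂ * Real.exp (-min ν₁ ν₂ * |ξ|) :=
    fun ξ => by gcongr; exacts [le_max_left _ _, min_le_left _ _]
  have e₂ : ∀ ξ : ℝ, C₂ * Real.exp (-ν₂ * |ξ|) ≤ max C₁ C₂ * Real.exp (-min ν₁ ν₂ * |ξ|) :=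
    fun ξ => by gcongr; exacts [le_max_right _ _, min_le_right _ _]
  refine ⟨max C₁ C₂, lt_max_of_lt_left hC₁, min ν₁ ν₂, lt_min hν₁ hν₂, fun ξ hξ => ?_,
    fun ξ hξ => ?_⟩
  · exact ⟨(h₁ ξ hξ).1.trans (e₁ ξ), (h₁ ξ hξ).2.trans (e₁ ξ)⟩
  · have := h₂ (-ξ) (by linarith)
    simp only [neg_neg, abs_neg] at this
    rw [abs_sub_comm]
    exact ⟨this.1.trans (e₂ ξ), this.2.trans (e₂ ξ)⟩

end IsFrontODE

/-! ### From profiles to fronts -/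

/-- A profile generates an increasing solution of `U' = Q(U) / r` running from `0` to `1`: it is the
inverse of `u ↦ ∫ x in 1/2..u, r / Q x`, which maps `(0, 1)` onto `ℝ` because of the linear bounds on
`Q` at `0` and `1`. -/
theorem IsProfile.exists_trajectory {f g : ℝ → ℝ} {γ r : ℝ} {Q : ℝ → ℝ} (h : IsProfile f g γ Q)
    (hf : IsBistable f) (hg : ContinuousOn g (Icc 0 1)) (hr : 0 < r) :
    ∃ U : ℝ → ℝ, (∀ ξ, U ξ ∈ Ioo (0 : ℝ) 1) ∧ (∀ ξ, HasDerivAt U (Q (U ξ) / r) ξ) ∧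
      Tendsto U atBot (𝓝 0) ∧ Tendsto U atTop (𝓝 1) := by
  have hhalf : (1 / 2 : ℝ) ∈ Ioo (0 : ℝ) 1 := by norm_num
  have hcont : ContinuousOn (fun u => r / Q u) (Ioo 0 1) :=
    continuousOn_const.div (h.cont.mono Ioo_subset_Icc_self) fun u hu => (h.pos u hu).ne'
  set T : ℝ → ℝ := fun u => ∫ x in (1 / 2)..u, r / Q x with hT
  have hdT : ∀ u ∈ Ioo (0 : ℝ) 1, HasDerivAt T (r / Q u) u := by
    intro u hu
    refine intervalIntegral.integral_hasDerivAt_right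
      (hcont.mono (ordConnected_Ioo.uIcc_subset hhalf hu)).intervalIntegrable
      (hcont.stronglyMeasurableAtFilter isOpen_Ioo u hu)
      (hcont.continuousAt (isOpen_Ioo.mem_nhds hu))
  have hpos : ∀ u ∈ Ioo (0 : ℝ) 1, 0 < r / Q u := fun u hu => div_pos hr (h.pos u hu)
  have hmono : StrictMonoOn T (Ioo 0 1) :=
    strictMonoOn_of_hasDerivWithinAt_pos (convex_Ioo 0 1)
      (fun u hu => (hdT u hu).continuousAt.continuousWithinAt)
      (by rw [interior_Ioo]; exact fun u hu => (hdT u hu).hasDerivWithinAt)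
      (by rw [interior_Ioo]; exact hpos)
  obtain ⟨C, hC, hCQ⟩ := h.exists_le_mul hf hg
  obtain ⟨B, hB, hBQ⟩ := h.reflect.exists_le_mul hf.reflect
    (hg.comp (by fun_prop) fun u hu => ⟨by linarith [hu.2], by linarith [hu.1]⟩)
  have hlow : MonotoneOn (fun u => T u - r / C * Real.log u) (Ioo 0 1) := by
    have hd : ∀ u ∈ Ioo (0 : ℝ) 1, HasDerivAt (fun u => T u - r / C * Real.log u)
        (r / Q u - r / C * u⁻¹) u := fun u hu =>
      (hdT u hu).fun_sub ((Real.hasDerivAt_log hu.1.ne').const_mul _)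
    refine monotoneOn_of_hasDerivWithinAt_nonneg (convex_Ioo 0 1)
      (fun u hu => (hd u hu).continuousAt.continuousWithinAt)
      (by rw [interior_Ioo]; exact fun u hu => (hd u hu).hasDerivWithinAt) ?_
    rw [interior_Ioo]
    intro u hu
    rw [← div_eq_mul_inv, div_div, sub_nonneg]
    exact div_le_div_of_nonneg_left hr.le (h.pos u hu) (hCQ u (Ioo_subset_Icc_self hu))
  have hupp : MonotoneOn (fun u => T u + r / B * Real.log (1 - u)) (Ioo 0 1) := by
    have hd : ∀ u ∈ Ioo (0 : ℝ) 1, HasDerivAt (fun u => T u + r / B * Real.log (1 - u))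
        (r / Q u + r / B * (-1 / (1 - u))) u := fun u hu =>
      (hdT u hu).fun_add ((((hasDerivAt_id u).const_sub 1).log (sub_pos.2 hu.2).ne').const_mul _)
    refine monotoneOn_of_hasDerivWithinAt_nonneg (convex_Ioo 0 1)
      (fun u hu => (hd u hu).continuousAt.continuousWithinAt)
      (by rw [interior_Ioo]; exact fun u hu => (hd u hu).hasDerivWithinAt) ?_
    rw [interior_Ioo]
    intro u hu
    have h1 := hBQ (1 - u) ⟨by linarith [hu.2], by linarith [hu.1]⟩
    rw [sub_sub_cancel] at h1
    have h2 := div_le_div_of_nonneg_left hr.le (h.pos u hu) h1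
    rw [← div_div] at h2
    have : r / B * (-1 / (1 - u)) = -(r / B / (1 - u)) := by ring
    linarith
  have hsmall : ∀ y, ∃ u ∈ Ioo (0 : ℝ) 1, T u ≤ y := by
    intro y
    have h1 : Tendsto (fun u => T (1 / 2) - r / C * Real.log (1 / 2) + r / C * Real.log u)
        (𝓝[>] 0) atBot :=
      tendsto_atBot_add_const_left _ _
        ((Real.tendsto_log_nhdsGT_zero).const_mul_atBot (div_pos hr hC))
    obtain ⟨u, hu, hu2⟩ := ((h1.eventually_le_atBot y).and (Ioo_mem_nhdsGT hhalf.1)).exists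
    have hu' : u ∈ Ioo (0 : ℝ) 1 := ⟨hu2.1, hu2.2.trans hhalf.2⟩
    have := hlow hu' hhalf hu2.2.le
    exact ⟨u, hu', by simp only at this; linarith⟩
  have hlarge : ∀ y, ∃ u ∈ Ioo (0 : ℝ) 1, y ≤ T u := by
    intro y
    have h1 : Tendsto (fun u => T (1 / 2) + r / B * Real.log (1 / 2) + -(r / B * Real.log u))
        (𝓝[>] 0) atTop :=
      tendsto_atTop_add_const_left _ _ (tendsto_neg_atBot_atTop.comp
        ((Real.tendsto_log_nhdsGT_zero).const_mul_atBot (div_pos hr hB)))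
    obtain ⟨u, hu, hu2⟩ := ((h1.eventually_ge_atTop y).and (Ioo_mem_nhdsGT hhalf.1)).exists
    have hu' : 1 - u ∈ Ioo (0 : ℝ) 1 := ⟨by linarith [hu2.2, hhalf.2], by linarith [hu2.1]⟩
    have := hupp hhalf hu' (by linarith [hu2.2])
    refine ⟨1 - u, hu', ?_⟩
    simp only [sub_sub_cancel] at this
    rw [show (1 : ℝ) - 1 / 2 = 1 / 2 by norm_num] at this
    linarith
  have himg : T '' Ioo 0 1 = univ := by
    refine eq_univ_of_forall fun y => ?_
    obtain ⟨a, ha, hay⟩ := hsmall y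
    obtain ⟨b, hb, hby⟩ := hlarge y
    exact isPreconnected_Ioo.intermediate_value ha hb
      (fun u hu => (hdT u hu).continuousAt.continuousWithinAt) ⟨hay, hby⟩
  obtain ⟨U, hU, hUT, hdU, hUm⟩ := exists_inverse_of_strictMonoOn isOpen_Ioo isOpen_univ hdT
    (fun u hu => (hpos u hu).ne') hmono himg
  have hUI : ∀ ξ, U ξ ∈ Ioo (0 : ℝ) 1 := fun ξ => (hU ξ (mem_univ _)).1
  have hUmono : StrictMono U := strictMonoOn_univ.1 hUm
  refine ⟨U, hUI, fun ξ => (hdU ξ (mem_univ _)).congr_deriv (inv_div _ _), ?_, ?_⟩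
  · refine tendsto_order.2 ⟨fun a ha => Eventually.of_forall fun ξ => ha.trans (hUI ξ).1,
      fun a ha => ?_⟩
    have hb : min a (1 / 2) ∈ Ioo (0 : ℝ) 1 :=
      ⟨lt_min ha hhalf.1, (min_le_right _ _).trans_lt hhalf.2⟩
    filter_upwards [eventually_lt_atBot (T (min a (1 / 2)))] with ξ hξ
    exact (hUmono hξ).trans_le ((hUT _ hb).trans_le (min_le_left _ _))
  · refine tendsto_order.2 ⟨fun a ha => ?_,
      fun a ha => Eventually.of_forall fun ξ => (hUI ξ).2.trans ha⟩
    have hb : max a (1 / 2) ∈ Ioo (0 : ℝ) 1 :=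
      ⟨hhalf.1.trans_le (le_max_right _ _), max_lt ha hhalf.2⟩
    filter_upwards [eventually_gt_atTop (T (max a (1 / 2)))] with ξ hξ
    exact (le_max_left _ _).trans_lt ((hUT _ hb).symm.trans_lt (hUmono hξ))

/-- The wave speed belonging to the speed parameter `γ` of a profile; for `τ ≥ 0` it is the solution
`c` of `c / √(1 - c ^ 2 * τ) = γ`. -/
noncomputable def waveSpeed (τ γ : ℝ) : ℝ := γ / √(1 + τ * γ ^ 2)

theorem one_sub_waveSpeed_sq_mul {τ : ℝ} (hτ : 0 ≤ τ) (γ : ℝ) :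
    1 - waveSpeed τ γ ^ 2 * τ = (1 + τ * γ ^ 2)⁻¹ := by
  have h : 0 < 1 + τ * γ ^ 2 := by positivity
  rw [waveSpeed, div_pow, Real.sq_sqrt h.le]
  field_simp
  ring

theorem waveSpeed_div_sqrt {τ : ℝ} (hτ : 0 ≤ τ) (γ : ℝ) :
    waveSpeed τ γ / √(1 - waveSpeed τ γ ^ 2 * τ) = γ := by
  have h : 0 < √(1 + τ * γ ^ 2) := Real.sqrt_pos.2 (by positivity)
  rw [one_sub_waveSpeed_sq_mul hτ, Real.sqrt_inv, waveSpeed]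
  field_simp

theorem waveSpeed_of_div_sqrt {τ c : ℝ} (hk : 0 < 1 - c ^ 2 * τ) :
    waveSpeed τ (c / √(1 - c ^ 2 * τ)) = c := by
  have hs := Real.sqrt_pos.2 hk
  have : 1 + τ * (c / √(1 - c ^ 2 * τ)) ^ 2 = (1 - c ^ 2 * τ)⁻¹ := by
    rw [div_pow, Real.sq_sqrt hk.le]
    apply eq_inv_of_mul_eq_one_left
    rw [add_mul, mul_assoc, div_mul_cancel₀ _ hk.ne']
    ring
  rw [waveSpeed, this, Real.sqrt_inv]
  field_simp

theorem IsProfile.exists_isFrontODE {f : ℝ → ℝ} {τ γ : ℝ} {Q : ℝ → ℝ}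
    (h : IsProfile f (fun u => 1 - τ * deriv f u) γ Q) (hf : IsBistable f) (hτ : 0 ≤ τ) :
    ∃ U V, IsFrontODE τ f (waveSpeed τ γ) U V := by
  have hk : 0 < 1 - waveSpeed τ γ ^ 2 * τ := by
    rw [one_sub_waveSpeed_sq_mul hτ]; positivity
  have hγ := waveSpeed_div_sqrt hτ γ
  have hgc : ContinuousOn (fun u => 1 - τ * deriv f u) (Icc 0 1) :=
    (continuous_const.sub (continuous_const.mul (hf.1.continuous_deriv le_rfl))).continuousOn
  set c := waveSpeed τ γ with hc
  have hr : 0 < √(1 - c ^ 2 * τ) := Real.sqrt_pos.2 hk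
  have hrr : √(1 - c ^ 2 * τ) * √(1 - c ^ 2 * τ) = 1 - c ^ 2 * τ := Real.mul_self_sqrt hk.le
  set r := √(1 - c ^ 2 * τ) with hrdef
  obtain ⟨U, hUI, hdU, hbot, htop⟩ := h.exists_trajectory hf hgc hr
  have hγc : γ * r = c := by rw [← hγ, div_mul_cancel₀ _ hr.ne']
  have hQlim : ∀ {F : Filter ℝ} {a : ℝ}, a ∈ Icc (0 : ℝ) 1 → Q a = 0 → f a = 0 →
      Tendsto U F (𝓝 a) →
      Tendsto (fun ξ => r * Q (U ξ) - c * τ * f (U ξ)) F (𝓝 0) := by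
    intro F a ha hQa hfa hU
    have h1 : Tendsto (fun ξ => Q (U ξ)) F (𝓝 0) := by
      rw [← hQa]
      exact (h.cont a ha).tendsto.comp (tendsto_nhdsWithin_iff.2
        ⟨hU, Eventually.of_forall fun ξ => Ioo_subset_Icc_self (hUI ξ)⟩)
    have h2 : Tendsto (fun ξ => f (U ξ)) F (𝓝 0) := by
      rw [← hfa]
      exact (hf.1.continuous.tendsto a).comp hU
    simpa using (h1.const_mul r).sub (h2.const_mul (c * τ))
  refine ⟨U, fun ξ => r * Q (U ξ) - c * τ * f (U ξ), fun ξ => ?_, fun ξ => ?_, hbot,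
    hQlim (left_mem_Icc.2 zero_le_one) h.zero hf.zero_left hbot, htop,
    hQlim (right_mem_Icc.2 zero_le_one) h.one ?_ htop⟩
  · refine (hdU ξ).congr_deriv ?_
    rw [← hrr]
    field_simp
    ring
  · have hdf : HasDerivAt (fun ξ => f (U ξ)) _ ξ :=
      (hf.1.differentiable one_ne_zero (U ξ)).hasDerivAt.comp ξ (hdU ξ)
    have hdQ : HasDerivAt (fun ξ => Q (U ξ)) _ ξ := (h.hasDerivAt _ (hUI ξ)).comp ξ (hdU ξ)
    refine ((hdQ.const_mul r).fun_sub (hdf.const_mul (c * τ))).congr_deriv ?_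
    have hQ := (h.pos _ (hUI ξ)).ne'
    rw [eq_div_iff hk.ne']
    have e1 : (-γ * (1 - τ * deriv f (U ξ)) - f (U ξ) / Q (U ξ)) * Q (U ξ) =
        -γ * (1 - τ * deriv f (U ξ)) * Q (U ξ) - f (U ξ) := by field_simp
    have e2 : Q (U ξ) / r * r = Q (U ξ) := div_mul_cancel₀ _ hr.ne'
    generalize Q (U ξ) / r = q at *
    generalize -γ * (1 - τ * deriv f (U ξ)) - f (U ξ) / Q (U ξ) = X at *
    linear_combination (1 - c ^ 2 * τ) * (X * e2 + e1 - γ * τ * deriv f (U ξ) * e2 +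
      τ * deriv f (U ξ) * q * hγc) - Q (U ξ) * r * hγc + Q (U ξ) * γ * hrr
  · have := hf.reflect.zero_left
    simpa using this

/-! ### Uniqueness and continuity of the speed -/

theorem tauM_pos_and_damping_pos {f : ℝ → ℝ} (hf : IsBistable f) :
    0 < tauM f ∧ ∀ τ ∈ Ico 0 (tauM f), ∀ u ∈ Icc (0 : ℝ) 1, 0 < 1 - τ * deriv f u := by
  have hc := hf.1.continuous_deriv le_rfl
  have hb : BddAbove ((fun u => |deriv f u|) '' Icc (0 : ℝ) 1) :=
    (isCompact_Icc.image hc.abs).bddAbove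
  obtain ⟨-, α, -, -, -, -, d0, -⟩ := hf
  have hle : ∀ u ∈ Icc (0 : ℝ) 1, |deriv f u| ≤ sSup ((fun u => |deriv f u|) '' Icc (0 : ℝ) 1) :=
    fun u hu => le_csSup hb (mem_image_of_mem _ hu)
  have hS : 0 < sSup ((fun u => |deriv f u|) '' Icc (0 : ℝ) 1) :=
    (abs_pos.2 d0.ne).trans_le (hle 0 (left_mem_Icc.2 zero_le_one))
  refine ⟨one_div_pos.2 hS, fun τ hτ u hu => ?_⟩
  have h1 := hτ.2
  rw [tauM, lt_div_iff₀ hS] at h1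
  have := mul_le_mul_of_nonneg_left ((le_abs_self _).trans (hle u hu)) hτ.1
  linarith

/-- The speed parameter is determined by the reaction and the damping. -/
theorem IsProfile.eq_of_isProfile {f g : ℝ → ℝ} {γ₁ γ₂ : ℝ} {Q₁ Q₂ : ℝ → ℝ} (hf : IsBistable f)
    (hg : ∀ u ∈ Icc (0 : ℝ) 1, 0 < g u) (h₁ : IsProfile f g γ₁ Q₁) (h₂ : IsProfile f g γ₂ Q₂) :
    γ₁ = γ₂ := by
  obtain ⟨-, α, hα, -, hα0, -, -, -, -, hp, hn⟩ := hf
  have key : ∀ {γ₁ γ₂ : ℝ} {Q₁ Q₂ : ℝ → ℝ}, IsProfile f g γ₁ Q₁ → IsProfile f g γ₂ Q₂ →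
      ¬ γ₁ < γ₂ := fun h₁ h₂ hlt =>
    h₁.not_forall_mul_lt hα hα0 (fun u hu => hn u (Or.inl hu)) (fun u hu => hp u (Or.inr hu)) h₂
      fun u hu => mul_lt_mul_of_pos_right hlt (hg u hu)
  exact le_antisymm (not_lt.1 (key h₂ h₁)) (not_lt.1 (key h₁ h₂))

/-- The speed parameter depends continuously on `τ`: if `γ τ ≥ a > γ τ₀` for some `τ` close to `τ₀`,
then `γ τ (1 - τ f') > γ τ₀ (1 - τ₀ f')` on `[0, 1]`, which the comparison of profiles excludes. -/
theorem continuousOn_of_isProfile {f : ℝ → ℝ} (hf : IsBistable f) {s : Set ℝ} {γ : ℝ → ℝ}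
    {Q : ℝ → ℝ → ℝ} (hg : ∀ τ ∈ s, ∀ u ∈ Icc (0 : ℝ) 1, 0 < 1 - τ * deriv f u)
    (h : ∀ τ ∈ s, IsProfile f (fun u => 1 - τ * deriv f u) (γ τ) (Q τ)) : ContinuousOn γ s := by
  have hc := hf.1.continuous_deriv le_rfl
  obtain ⟨-, α, hα, -, hα0, -, -, -, -, hp, hn⟩ := hf
  have cmp : ∀ τ₁ ∈ s, ∀ τ₂ ∈ s,
      ¬ ∀ u ∈ Icc (0 : ℝ) 1, γ τ₁ * (1 - τ₁ * deriv f u) < γ τ₂ * (1 - τ₂ * deriv f u) :=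
    fun τ₁ h₁ τ₂ h₂ => (h τ₁ h₁).not_forall_mul_lt hα hα0 (fun u hu => hn u (Or.inl hu))
      (fun u hu => hp u (Or.inr hu)) (h τ₂ h₂)
  intro τ₀ hτ₀
  -- near `τ₀`, a strict inequality between the products persists uniformly on `[0, 1]`
  have hunif : ∀ (a b : ℝ), (∀ u ∈ Icc (0 : ℝ) 1, 0 < a * (1 - τ₀ * deriv f u)
      + b * (1 - τ₀ * deriv f u)) → ∀ᶠ τ in 𝓝[s] τ₀, ∀ u ∈ Icc (0 : ℝ) 1,
        0 < a * (1 - τ₀ * deriv f u) + b * (1 - τ * deriv f u) := by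
    intro a b hab
    refine Filter.Eventually.filter_mono nhdsWithin_le_nhds ?_
    refine isCompact_Icc.eventually_forall_of_forall_eventually fun u hu => ?_
    have hcont : Continuous fun p : ℝ × ℝ =>
        a * (1 - τ₀ * deriv f p.2) + b * (1 - p.1 * deriv f p.2) := by fun_prop
    exact (hcont.tendsto (τ₀, u)).eventually_const_lt (hab u hu)
  refine tendsto_order.2 ⟨fun a ha => ?_, fun a ha => ?_⟩
  · filter_upwards [hunif (γ τ₀) (-a) (fun u hu => by
      have := mul_pos (sub_pos.2 ha) (hg τ₀ hτ₀ u hu)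
      linarith), self_mem_nhdsWithin] with τ hτ hτs
    by_contra! hle
    refine cmp τ hτs τ₀ hτ₀ fun u hu => ?_
    have := mul_le_mul_of_nonneg_right hle (hg τ hτs u hu).le
    linarith [hτ u hu]
  · filter_upwards [hunif (-γ τ₀) a (fun u hu => by
      have := mul_pos (sub_pos.2 ha) (hg τ₀ hτ₀ u hu)
      linarith), self_mem_nhdsWithin] with τ hτ hτs
    by_contra! hle
    refine cmp τ₀ hτ₀ τ hτs fun u hu => ?_
    have := mul_le_mul_of_nonneg_right hle (hg τ hτs u hu).le
    linarith [hτ u hu]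

theorem mem_Ioo_one_div_sqrt_iff {τ c : ℝ} (hτ : 0 < τ) :
    c ∈ Ioo (-(1 / √τ)) (1 / √τ) ↔ 0 < 1 - c ^ 2 * τ := by
  have hs := Real.sqrt_pos.2 hτ
  have h : c ^ 2 * τ = (|c| * √τ) ^ 2 := by rw [mul_pow, sq_abs, Real.sq_sqrt hτ.le]
  rw [mem_Ioo, ← abs_lt, lt_div_iff₀ hs, sub_pos, h, sq_lt_one_iff₀ (by positivity)]

theorem theorem1p1 (f : ℝ → ℝ) (hf : IsBistable f) :
    ∃ (c₀ : ℝ) (cs : ℝ → ℝ),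
      -- `c₀` is the speed of the parabolic Allen--Cahn equation
      ((∃ U : ℝ → ℝ, IsParabolicFront f c₀ U) ∧
        ∀ (c : ℝ) (U : ℝ → ℝ), IsParabolicFront f c U → c = c₀) ∧
      -- for every admissible `τ`, `cs τ` is the unique speed of the relaxation system
      (∀ τ ∈ Ioo 0 (tauM f),
        cs τ ∈ Ioo (-(1 / √τ)) (1 / √τ) ∧
        (∃ U V : ℝ → ℝ, IsRelaxationFront τ f (cs τ) U V) ∧
        (∀ c ∈ Ioo (-(1 / √τ)) (1 / √τ),
          (∃ U V : ℝ → ℝ, IsRelaxationFront τ f c U V) → c = cs τ) ∧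
        -- properties of the front
        ∀ U V : ℝ → ℝ, IsRelaxationFront τ f (cs τ) U V →
          StrictMono U ∧
          (∀ ξ : ℝ, 0 < U ξ ∧ 0 < V ξ) ∧
          ∃ C > 0, ∃ ν > 0,
            (∀ ξ ≤ 0, |U ξ| ≤ C * Real.exp (-ν * |ξ|) ∧ |V ξ| ≤ C * Real.exp (-ν * |ξ|)) ∧
            (∀ ξ ≥ 0, |U ξ - 1| ≤ C * Real.exp (-ν * |ξ|) ∧ |V ξ| ≤ C * Real.exp (-ν * |ξ|))) ∧
      -- dependence of the speed on `τ`
      ContinuousOn cs (Ioo 0 (tauM f)) ∧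
      Tendsto cs (𝓝[>] 0) (𝓝 c₀) := by
  obtain ⟨hτm, hg⟩ := tauM_pos_and_damping_pos hf
  have hex : ∀ τ ∈ Ico 0 (tauM f), ∃ γ Q, IsProfile f (fun u => 1 - τ * deriv f u) γ Q := by
    intro τ hτ
    have hg' := hg τ hτ
    obtain ⟨hC, α, hα, -, -, -, -, -, -, hp, hn⟩ := hf
    exact exists_isProfile hC.continuous
      (continuous_const.sub (continuous_const.mul (hC.continuous_deriv le_rfl))) hg' hα
      (fun u hu => hn u (Or.inl hu)) fun u hu => hp u (Or.inr hu)
  choose! γ Q hQ using hex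
  have hspeed : ∀ {τ c : ℝ} {U V : ℝ → ℝ}, τ ∈ Ico 0 (tauM f) → 0 < 1 - c ^ 2 * τ →
      IsFrontODE τ f c U V → c = waveSpeed τ (γ τ) := by
    intro τ c U V hτ hk h
    obtain ⟨P, hP, -⟩ := h.exists_isProfile hf hk (hg τ hτ)
    rw [← hP.eq_of_isProfile hf (hg τ hτ) (hQ τ hτ), waveSpeed_of_div_sqrt hk]
  have hγ : ContinuousOn γ (Ico 0 (tauM f)) := continuousOn_of_isProfile hf hg hQ
  have hcs : ContinuousOn (fun τ => waveSpeed τ (γ τ)) (Ico 0 (tauM f)) := by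
    refine hγ.div ((continuousOn_const.add (continuousOn_id.mul (hγ.pow 2))).sqrt) fun τ hτ => ?_
    have := hτ.1
    exact (Real.sqrt_pos.2 (by positivity)).ne'
  have h0 : (0 : ℝ) ∈ Ico 0 (tauM f) := ⟨le_rfl, hτm⟩
  -- the parabolic equation is the case `τ = 0`
  refine ⟨waveSpeed 0 (γ 0), fun τ => waveSpeed τ (γ τ), ⟨?_, fun c U hU => ?_⟩,
    fun τ hτ => ?_, hcs.mono Ioo_subset_Ico_self, ?_⟩
  · obtain ⟨U, V, h⟩ := (hQ 0 h0).exists_isFrontODE hf le_rfl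
    exact ⟨U, h.isParabolicFront⟩
  · have hf1 : f 1 = 0 := by simpa using hf.reflect.zero_left
    exact hspeed h0 (by simp) (hU.isFrontODE hf.1.continuous hf.zero_left hf1)
  · have hτ' := Ioo_subset_Ico_self hτ
    have hk : 0 < 1 - waveSpeed τ (γ τ) ^ 2 * τ := by
      rw [one_sub_waveSpeed_sq_mul hτ.1.le]
      have := hτ.1
      positivity
    refine ⟨(mem_Ioo_one_div_sqrt_iff hτ.1).2 hk, ?_, ?_, fun U V h => ?_⟩
    · obtain ⟨U, V, h⟩ := (hQ τ hτ').exists_isFrontODE hf hτ.1.le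
      exact ⟨U, V, (isRelaxationFront_iff hk).2 h⟩
    · rintro c hc ⟨U, V, h⟩
      rw [mem_Ioo_one_div_sqrt_iff hτ.1] at hc
      exact hspeed hτ' hc ((isRelaxationFront_iff hc).1 h)
    · have h' := (isRelaxationFront_iff hk).1 h
      exact ⟨h'.strictMono hf hk (hg τ hτ'),
        fun ξ => ⟨h'.pos hf hk ξ, h'.pos_V hf hk (hg τ hτ') ξ⟩,
        h'.exists_exp_bound hf hk (hg τ hτ')⟩
  · refine (hcs 0 h0).tendsto.mono_left ?_
    rw [nhdsWithin_Ico_eq_nhdsGE hτm]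
    exact nhdsWithin_mono _ Ioi_subset_Ici_self
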